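/- Let $\mathfrak g$ be a finite-dimensional simple complex Lie algebra with Cartan subalgebra $\mathfrak h$ and Killing form $(\cdot,\cdot)$. Let $A=\mathbb C[t_1^{\pm1},\dots,t_n^{\pm1}]$, let $\Omega_A$ be the free $A$-module with basis $K_1,\dots,K_n$, let $dA\subset\Omega_A$ be the span of the elements $\sum_i m_it^mK_i$ ($m\in\mathbb Z^n$), and let $\mathcal K_A=\Omega_A/dA$. Let $d_i=t_i\,\partial/\partial t_i$, so that the $t^rd_i$ form a basis of $\mathrm{Der}(A)$. Let $c_1,c_2\in\mathbb C$ and $\phi=c_1\phi_1+c_2\phi_2$, where $$\phi_1(t^rd_i,t^sd_j)=-s_ir_j\sum_p r_pt^{r+s}K_p,\qquad \phi_2(t^rd_i,t^sd_j)=r_is_j\sum_p r_pt^{r+s}K_p .$$ The full toroidal Lie algebra is $\mathcal L=\mathfrak g\otimes A\oplus\mathcal K_A\oplus\mathrm{Der}(A)$ with brackets, where $x(r)=x\otimes t^r$, $$[x(r),y(s)]=[x,y](r+s)+(x,y)\sum_i r_it^{r+s}K_i,\quad [\mathfrak g\otimes A,\mathcal K_A]=[\mathcal K_A,\mathcal K_A]=0,\quad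 [t^rd_i,x(s)]=s_i\,x(r+s),$$ $$[t^rd_i,t^sK_j]=s_it^{r+s}K_j+\delta_{ij}\sum_p r_pt^{r+s}K_p,\quad [t^rd_i,t^sd_j]=s_it^{r+s}d_j-r_jt^{r+s}d_i+\phi(t^rd_i,t^sd_j).$$ Put $\tilde{\mathfrak h}_n=\mathfrak h\oplus\bigoplus_i\mathbb Cd_i\subset\mathcal L$. For a Lie algebra $\mathfrak a$ and a finite-dimensional abelian subalgebra $\mathfrak b$, let $\mathcal M(\mathfrak a,\mathfrak b)$ be the class of $\mathfrak a$-modules whose restriction to $U(\mathfrak b)$ is free of rank one. For $\Lambda=(\lambda_1,\dots,\lambda_n)\in(\mathbb C^*)^n$, $a\in\mathbb C$ and $M_{\mathfrak g}\in\mathcal M(\mathfrak g,\mathfrak h)$, let $\widehat M_{\mathcal L}(\Lambda,a,M_{\mathfrak g})$ be the $\mathcal L$-module $M_{\mathfrak g}\otimes\mathbb C[d_1,\dots,d_n]$ $(\cong U(\mathfrak h)\otimes\mathbb C[d_1,\dots,d_n]=U(\tilde{\mathfrak h}_n))$ with $$t^rK_j\cdot(v\otimes p)=0,\qquad x(r)\cdot(v\otimes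 p)=\Lambda^r\,(x v)\otimes\tau^r(p),\qquad t^rd_i\cdot(v\otimes p)=\Lambda^r\,v\otimes\tau^r(p)\bigl(d_i-r_i(a+1)\bigr)$$ for $x\in\mathfrak g$, $r\in\mathbb Z^n$, where $\Lambda^r=\prod_j\lambda_j^{r_j}$ and $\tau^r$ is the automorphism of $\mathbb C[d_1,\dots,d_n]$ with $\tau^r(d_j)=d_j-r_j$. **Theorem.** Every $M\in\mathcal M(\mathcal L,\tilde{\mathfrak h}_n)$ is isomorphic as an $\mathcal L$-module to $\widehat M_{\mathcal L}(\Lambda,a,M_{\mathfrak g})$ for some $\Lambda\in(\mathbb C^*)^n$, $a\in\mathbb C$ and $M_{\mathfrak g}\in\mathcal M(\mathfrak g,\mathfrak h)$. -/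

import Mathlib

universe u v

open scoped TensorProduct

noncomputable section

namespace FullToroidal

/-! ### Laurent polynomials, the Witt algebra and Kähler differentials modulo exact ones -/

/-- The Laurent polynomial ring `A = ℂ[t₁^±¹, …, tₙ^±¹]`, the group algebra of `ℤⁿ`. -/
def Laurent (n : ℕ) : Type := AddMonoidAlgebra ℂ (Fin n → ℤ)

instance (n : ℕ) : CommRing (Laurent n) :=
  inferInstanceAs (CommRing (AddMonoidAlgebra ℂ (Fin n → ℤ)))

instance (n : ℕ) : Algebra ℂ (Laurent n) :=
  inferInstanceAs (Algebra ℂ (AddMonoidAlgebra ℂ (Fin n → ℤ)))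

/-- The monomial `t^r`, `r ∈ ℤⁿ`. -/
def mono {n : ℕ} (r : Fin n → ℤ) : Laurent n :=
  (AddMonoidAlgebra.single r 1 : AddMonoidAlgebra ℂ (Fin n → ℤ))

/-- The Witt algebra `Der(A)`; its Lie bracket is the commutator of derivations. -/
abbrev Witt (n : ℕ) : Type := Derivation ℂ (Laurent n) (Laurent n)

theorem mono_add {n : ℕ} (r s : Fin n → ℤ) : mono (r + s) = mono r * mono s := by
  have h := AddMonoidAlgebra.single_mul_single (R := ℂ) r s 1 1
  rw [mul_one] at h
  exact h.symm

theorem mono_zero {n : ℕ} : mono (0 : Fin n → ℤ) = 1 := rfl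

theorem laurent_induction {n : ℕ} {P : Laurent n → Prop} (f : Laurent n)
    (hm : ∀ r, P (mono r)) (ha : ∀ f g, P f → P g → P (f + g))
    (hs : ∀ (c : ℂ) f, P f → P (c • f)) : P f := by
  refine AddMonoidAlgebra.induction_linear (motive := P) f ?_ ha fun r c => ?_
  · have h := hs 0 _ (hm 0)
    rw [zero_smul] at h
    exact h
  · have h : (AddMonoidAlgebra.single r c : AddMonoidAlgebra ℂ (Fin n → ℤ))
        = c • AddMonoidAlgebra.single r 1 := by simp
    rw [h]
    exact hs c _ (hm r)

/-- The monomials form a basis of `A`. -/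
def monoBasis (n : ℕ) : Module.Basis (Fin n → ℤ) ℂ (Laurent n) :=
  AddMonoidAlgebra.basis (Fin n → ℤ) ℂ

theorem monoBasis_apply {n : ℕ} (r : Fin n → ℤ) : monoBasis n r = mono r :=
  AddMonoidAlgebra.basis_apply ℂ r

/-- The linear map underlying `dᵢ = tᵢ ∂/∂tᵢ`. -/
def eulerLin {n : ℕ} (i : Fin n) : Laurent n →ₗ[ℂ] Laurent n :=
  (monoBasis n).constr ℂ fun r => (r i : ℂ) • mono r

theorem eulerLin_mono {n : ℕ} (i : Fin n) (r : Fin n → ℤ) :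
    eulerLin i (mono r) = (r i : ℂ) • mono r := by
  conv_lhs => rw [← monoBasis_apply, eulerLin, Module.Basis.constr_basis]

/-- The degree derivation `dᵢ = tᵢ ∂/∂tᵢ` of `A`: `dᵢ(t^r) = rᵢ t^r`. -/
def euler {n : ℕ} (i : Fin n) : Witt n :=
  Derivation.mk' (eulerLin i) fun f g => by
    induction f using laurent_induction with
    | ha f g hf hg => simp only [add_mul, map_add, hf, hg, add_smul, smul_add]; abel
    | hs c f hf => simp only [smul_mul_assoc, map_smul, hf, smul_add, smul_eq_mul, mul_smul_comm]
    | hm r =>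
      induction g using laurent_induction with
      | ha f g hf hg => simp only [mul_add, map_add, hf, hg, add_smul, smul_add]; abel
      | hs c f hf => simp only [smul_mul_assoc, map_smul, hf, smul_add, smul_eq_mul, mul_smul_comm]
      | hm s =>
        rw [← mono_add, eulerLin_mono, eulerLin_mono, eulerLin_mono, mono_add]
        simp only [Pi.add_apply, Int.cast_add, add_smul, smul_eq_mul, mul_smul_comm]
        rw [mul_comm (mono s)]
        abel

theorem euler_mono {n : ℕ} (i : Fin n) (r : Fin n → ℤ) :
    euler i (mono r) = (r i : ℂ) • mono r := eulerLin_mono i r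

/-- The `i`-th coefficient `uᵢ = tᵢ⁻¹ D(tᵢ)` of a derivation `D = ∑ uᵢ dᵢ` of `A`. -/
def coef {n : ℕ} (i : Fin n) : Witt n →ₗ[ℂ] Laurent n where
  toFun D := mono (-Pi.single i 1) * D (mono (Pi.single i 1))
  map_add' D E := by simp [mul_add]
  map_smul' c D := by simp

theorem mono_neg_mul {n : ℕ} (r : Fin n → ℤ) : mono (-r) * mono r = 1 := by
  rw [← mono_add, neg_add_cancel, mono_zero]

theorem mono_mul_neg {n : ℕ} (r : Fin n → ℤ) : mono r * mono (-r) = 1 := by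
  rw [← mono_add, add_neg_cancel, mono_zero]

theorem apply_mono_single {n : ℕ} (D : Witt n) (i : Fin n) :
    D (mono (Pi.single i 1)) = coef i D * mono (Pi.single i 1) := by
  change _ = (mono (-Pi.single i 1) * D (mono (Pi.single i 1))) * mono (Pi.single i 1)
  rw [mul_right_comm, mono_neg_mul, one_mul]

/-- Every derivation of `A` is `∑ uᵢ dᵢ`. -/
theorem witt_apply {n : ℕ} (D : Witt n) (f : Laurent n) :
    D f = ∑ i, coef i D * euler i f := by
  induction f using laurent_induction with
  | ha f g hf hg => simp only [map_add, hf, hg, mul_add, Finset.sum_add_distrib]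
  | hs c f hf => simp only [Derivation.map_smul, hf, Finset.smul_sum, mul_smul_comm]
  | hm r =>
    let φ : (Fin n → ℤ) →+ Laurent n :=
      { toFun := fun r => mono (-r) * D (mono r)
        map_zero' := by rw [mono_zero, D.map_one_eq_zero, mul_zero]
        map_add' := fun r s => by
          rw [mono_add, D.leibniz, neg_add, mono_add, smul_eq_mul, smul_eq_mul]
          have h1 := mono_neg_mul r
          have h2 := mono_neg_mul s
          linear_combination (mono (-s) * D (mono s)) * h1 + (mono (-r) * D (mono r)) * h2 }
    let ψ : (Fin n → ℤ) →+ Laurent n :=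
      { toFun := fun r => ∑ i, (r i : ℂ) • coef i D
        map_zero' := by simp
        map_add' := fun r s => by simp [add_smul, Finset.sum_add_distrib] }
    have h : φ = ψ := by
      refine AddMonoidHom.functions_ext' (I := Fin n) _ φ ψ fun i => AddMonoidHom.ext fun k => ?_
      change φ (Pi.single i k) = ψ (Pi.single i k)
      have key : φ (Pi.single i 1) = ψ (Pi.single i 1) := by
        change coef i D = ∑ j, ((Pi.single i 1 : Fin n → ℤ) j : ℂ) • coef j D
        rw [Finset.sum_eq_single i]
        · simp
        · intro j _ hj; simp [hj]
        · simp
      have e : (Pi.single i k : Fin n → ℤ) = k • Pi.single i 1 := by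
        rw [← Pi.single_smul]; simp
      rw [e, map_zsmul, map_zsmul, key]
    have h' : mono (-r) * D (mono r) = ∑ i, (r i : ℂ) • coef i D := DFunLike.congr_fun h r
    calc D (mono r) = mono r * (mono (-r) * D (mono r)) := by
          rw [← mul_assoc, mono_mul_neg, one_mul]
      _ = _ := by
          rw [h', Finset.mul_sum]
          refine Finset.sum_congr rfl fun i _ => ?_
          rw [euler_mono, mul_smul_comm, mul_smul_comm, mul_comm]

theorem euler_comm {n : ℕ} (i j : Fin n) (f : Laurent n) :
    euler i (euler j f) = euler j (euler i f) := by
  induction f using laurent_induction with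
  | ha f g hf hg => simp only [map_add, hf, hg]
  | hs c f hf => simp only [Derivation.map_smul, hf]
  | hm r => simp only [euler_mono, Derivation.map_smul]; rw [smul_comm]

theorem coef_lie {n : ℕ} (D E : Witt n) (i : Fin n) :
    coef i ⁅D, E⁆ = D (coef i E) - E (coef i D) := by
  have h : coef i ⁅D, E⁆ * mono (Pi.single i 1)
      = (D (coef i E) - E (coef i D)) * mono (Pi.single i 1) := by
    rw [← apply_mono_single, Derivation.commutator_apply, apply_mono_single, apply_mono_single,
      D.leibniz, E.leibniz, apply_mono_single, apply_mono_single]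
    simp only [smul_eq_mul]
    ring
  have h2 := congrArg (· * mono (-Pi.single i 1)) h
  simpa only [mul_assoc, mono_mul_neg, mul_one] using h2

theorem coef_smul_euler {n : ℕ} (f : Laurent n) (i j : Fin n) :
    coef j (f • euler i) = if i = j then f else 0 := by
  change mono (-Pi.single j 1) * (f * euler i (mono (Pi.single j 1))) = _
  rw [euler_mono]
  split_ifs with h
  · subst h
    simp only [Pi.single_eq_same, Int.cast_one, one_smul]
    rw [mul_left_comm, mono_neg_mul, mul_one]
  · simp [Pi.single_eq_of_ne h]

/-- The differential `d : A → Ω_A`, where `Ω_A = Aⁿ` is the free `A`-module with basis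
`K₁, …, Kₙ`; thus `d(t^m) = ∑ mᵢ t^m Kᵢ`. -/
def dForm (n : ℕ) : Laurent n →ₗ[ℂ] (Fin n → Laurent n) :=
  LinearMap.pi fun i => (euler i : Laurent n →ₗ[ℂ] Laurent n)

/-- `𝒦_A = Ω_A / dA`. -/
abbrev KA (n : ℕ) : Type := (Fin n → Laurent n) ⧸ LinearMap.range (dForm n)

/-- The class of a form `∑ fᵢ Kᵢ` in `𝒦_A`. -/
abbrev KA.mk {n : ℕ} (ω : Fin n → Laurent n) : KA n := (LinearMap.range (dForm n)).mkQ ω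

/-- The bilinear map `(f, g) ↦ [g df]` with values in `𝒦_A`;
`(t^a, t^b) ↦ ∑ aᵢ t^(a+b) Kᵢ`. -/
def dClass {n : ℕ} : Laurent n →ₗ[ℂ] Laurent n →ₗ[ℂ] KA n :=
  LinearMap.mk₂ ℂ (fun f g => KA.mk fun p => g * euler p f)
    (fun f f' g => by
      rw [← map_add]; congr 1; funext p; simp [mul_add])
    (fun c f g => by
      rw [← map_smul]; congr 1; funext p; simp)
    (fun f g g' => by
      rw [← map_add]; congr 1; funext p; simp [add_mul])
    (fun c f g => by
      rw [← map_smul]; congr 1; funext p; simp)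

theorem dClass_apply {n : ℕ} (f g : Laurent n) :
    dClass f g = KA.mk fun p => g * euler p f := rfl

theorem dClass_one {n : ℕ} (g : Laurent n) : dClass 1 g = 0 := by
  rw [dClass_apply]
  simp only [Derivation.map_one_eq_zero, mul_zero]
  exact map_zero _

theorem dClass_swap {n : ℕ} (f g : Laurent n) : dClass f g = -dClass g f := by
  rw [eq_neg_iff_add_eq_zero, dClass_apply, dClass_apply, ← map_add, Submodule.mkQ_apply,
    Submodule.Quotient.mk_eq_zero]
  refine ⟨f * g, funext fun p => ?_⟩
  change euler p (f * g) = g * euler p f + f * euler p g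
  rw [Derivation.leibniz, smul_eq_mul, smul_eq_mul, add_comm]

theorem dClass_mul {n : ℕ} (f g h : Laurent n) :
    dClass (f * g) h = dClass f (g * h) + dClass g (h * f) := by
  rw [dClass_apply, dClass_apply, dClass_apply, ← map_add]
  congr 1
  funext p
  simp only [Derivation.leibniz, smul_eq_mul, Pi.add_apply]
  ring

/-- The Lie derivative of forms: `D(∑ ωₚ Kₚ) = ∑ₚ (D(ωₚ) + ∑ⱼ ωⱼ dₚ(uⱼ)) Kₚ` for `D = ∑ uⱼ dⱼ`.
So `t^r dᵢ (t^s Kⱼ) = sᵢ t^(r+s) Kⱼ + δᵢⱼ ∑ rₚ t^(r+s) Kₚ`. -/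
def lieForm {n : ℕ} (D : Witt n) : (Fin n → Laurent n) →ₗ[ℂ] (Fin n → Laurent n) where
  toFun ω p := D (ω p) + ∑ j, ω j * euler p (coef j D)
  map_add' ω η := by
    funext p
    simp only [Pi.add_apply, map_add, add_mul, Finset.sum_add_distrib]
    abel
  map_smul' c ω := by
    funext p
    simp [Finset.smul_sum]

theorem lieForm_gdf {n : ℕ} (D : Witt n) (f g : Laurent n) :
    lieForm D (fun p => g * euler p f)
      = (fun p => g * euler p (D f)) + fun p => D g * euler p f := by
  funext p
  change D (g * euler p f) + ∑ j, g * euler j f * euler p (coef j D)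
    = g * euler p (D f) + D g * euler p f
  rw [D.leibniz, witt_apply D f, map_sum, witt_apply D (euler p f)]
  simp only [Derivation.leibniz, smul_eq_mul, Finset.sum_add_distrib, mul_add, Finset.mul_sum]
  have h1 : ∑ i, g * (coef i D * euler i (euler p f))
      = ∑ i, g * (coef i D * euler p (euler i f)) :=
    Finset.sum_congr rfl fun i _ => by rw [euler_comm]
  have h2 : ∑ j, g * euler j f * euler p (coef j D) = ∑ j, g * (euler j f * euler p (coef j D)) :=
    Finset.sum_congr rfl fun i _ => by rw [mul_assoc]
  rw [h1, h2]
  ring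

/-- The action of `Der(A)` on `𝒦_A` induced by the Lie derivative. -/
def lieKA {n : ℕ} (D : Witt n) : KA n →ₗ[ℂ] KA n :=
  Submodule.mapQ _ _ (lieForm D) (by
    rintro _ ⟨f, rfl⟩
    refine ⟨D f, ?_⟩
    have := lieForm_gdf D f 1
    simp only [one_mul, Derivation.map_one_eq_zero, zero_mul] at this
    change (fun p => euler p (D f)) = lieForm D (fun p => euler p f)
    rw [this]
    funext p
    simp)

theorem lieKA_dClass {n : ℕ} (D : Witt n) (f g : Laurent n) :
    lieKA D (dClass f g) = dClass (D f) g + dClass f (D g) := by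
  rw [dClass_apply, dClass_apply, dClass_apply, ← map_add, ← lieForm_gdf]
  rfl

theorem KA_induction {n : ℕ} {P : KA n → Prop} (k : KA n)
    (hc : ∀ f g, P (dClass f g)) (h0 : P 0) (ha : ∀ k l, P k → P l → P (k + l)) : P k := by
  obtain ⟨ω, rfl⟩ := Submodule.mkQ_surjective _ k
  have h : (LinearMap.range (dForm n)).mkQ ω
      = ∑ j, dClass (mono (Pi.single j 1)) (ω j * mono (-Pi.single j 1)) := by
    simp only [dClass_apply]
    rw [← map_sum]
    congr 1
    funext p
    rw [Finset.sum_apply, Finset.sum_eq_single p]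
    · rw [euler_mono]
      simp [mul_assoc, mono_neg_mul]
    · intro j _ hj
      rw [euler_mono]
      simp [Pi.single_eq_of_ne hj.symm]
    · simp
  rw [h]
  exact Finset.sum_induction _ P ha h0 fun j _ => hc _ _

theorem lieKA_lie {n : ℕ} (D E : Witt n) (k : KA n) :
    lieKA ⁅D, E⁆ k = lieKA D (lieKA E k) - lieKA E (lieKA D k) := by
  induction k using KA_induction with
  | h0 => simp
  | ha k l hk hl => simp only [map_add, hk, hl]; abel
  | hc f g =>
    simp only [lieKA_dClass, map_add, Derivation.commutator_apply, map_sub, LinearMap.sub_apply]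
    abel

theorem lieKA_add {n : ℕ} (D E : Witt n) (k : KA n) :
    lieKA (D + E) k = lieKA D k + lieKA E k := by
  induction k using KA_induction with
  | h0 => simp
  | ha k l hk hl => simp only [map_add, hk, hl]; abel
  | hc f g =>
    simp only [lieKA_dClass, map_add, Derivation.add_apply, LinearMap.add_apply]
    abel

theorem lieKA_smul {n : ℕ} (c : ℂ) (D : Witt n) (k : KA n) :
    lieKA (c • D) k = c • lieKA D k := by
  induction k using KA_induction with
  | h0 => simp
  | ha k l hk hl => simp only [map_add, hk, hl, smul_add]
  | hc f g =>
    simp only [lieKA_dClass, map_smul, Derivation.smul_apply, LinearMap.smul_apply, smul_add]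

/-! ### The two cocycles of the Witt algebra -/

/-- `φ₁(∑ uᵢ dᵢ, ∑ vⱼ dⱼ) = -∑ᵢⱼ [dᵢ(vⱼ) d(dⱼ(uᵢ))]`, that is,
`φ₁(t^r dᵢ, t^s dⱼ) = -sᵢ rⱼ ∑ rₚ t^(r+s) Kₚ`. -/
def phi₁ {n : ℕ} (D E : Witt n) : KA n :=
  -∑ i, ∑ j, dClass (euler j (coef i D)) (euler i (coef j E))

/-- `φ₂(∑ uᵢ dᵢ, ∑ vⱼ dⱼ) = ∑ᵢⱼ [dⱼ(vⱼ) d(dᵢ(uᵢ))]`, that is,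
`φ₂(t^r dᵢ, t^s dⱼ) = rᵢ sⱼ ∑ rₚ t^(r+s) Kₚ`. -/
def phi₂ {n : ℕ} (D E : Witt n) : KA n :=
  ∑ i, ∑ j, dClass (euler i (coef i D)) (euler j (coef j E))

theorem euler_apply_witt {n : ℕ} (D : Witt n) (f : Laurent n) (j : Fin n) :
    euler j (D f) = D (euler j f) + ∑ k, euler k f * euler j (coef k D) := by
  have h := congrFun (lieForm_gdf D f 1) j
  simp only [lieForm, LinearMap.coe_mk, AddHom.coe_mk, one_mul, Pi.add_apply,
    Derivation.map_one_eq_zero, zero_mul, add_zero] at h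
  exact h.symm

/-- The pairing `∑ᵢⱼ [Nⱼᵢ dMᵢⱼ]` of matrices over `A`. -/
def trPair {n : ℕ} (M N : Matrix (Fin n) (Fin n) (Laurent n)) : KA n :=
  ∑ i, ∑ j, dClass (M i j) (N j i)

theorem trPair_swap {n : ℕ} (M N : Matrix (Fin n) (Fin n) (Laurent n)) :
    trPair M N = -trPair N M := by
  unfold trPair
  rw [Finset.sum_comm, ← Finset.sum_neg_distrib]
  refine Finset.sum_congr rfl fun i _ => ?_
  rw [← Finset.sum_neg_distrib]
  exact Finset.sum_congr rfl fun j _ => dClass_swap _ _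

theorem trPair_add_left {n : ℕ} (M M' N : Matrix (Fin n) (Fin n) (Laurent n)) :
    trPair (M + M') N = trPair M N + trPair M' N := by
  simp [trPair, Finset.sum_add_distrib]

theorem trPair_sub_left {n : ℕ} (M M' N : Matrix (Fin n) (Fin n) (Laurent n)) :
    trPair (M - M') N = trPair M N - trPair M' N := by
  simp [trPair, Finset.sum_sub_distrib]

theorem trPair_add_right {n : ℕ} (M N N' : Matrix (Fin n) (Fin n) (Laurent n)) :
    trPair M (N + N') = trPair M N + trPair M N' := by
  simp [trPair, Finset.sum_add_distrib]

theorem trPair_sub_right {n : ℕ} (M N N' : Matrix (Fin n) (Fin n) (Laurent n)) :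
    trPair M (N - N') = trPair M N - trPair M N' := by
  simp [trPair, Finset.sum_sub_distrib]

theorem trPair_smul_left {n : ℕ} (c : ℂ) (M N : Matrix (Fin n) (Fin n) (Laurent n)) :
    trPair (c • M) N = c • trPair M N := by
  simp [trPair, Finset.smul_sum]

theorem trPair_mul {n : ℕ} (M N P : Matrix (Fin n) (Fin n) (Laurent n)) :
    trPair (M * N) P = trPair M (N * P) + trPair N (P * M) := by
  have hl : trPair (M * N) P = ∑ i, ∑ j, ∑ k, dClass (M i k) (N k j * P j i)
      + ∑ i, ∑ j, ∑ k, dClass (N k j) (P j i * M i k) := by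
    simp only [trPair, Matrix.mul_apply, map_sum, LinearMap.sum_apply, dClass_mul,
      Finset.sum_add_distrib]
  have h1 : trPair M (N * P) = ∑ i, ∑ k, ∑ j, dClass (M i k) (N k j * P j i) := by
    simp only [trPair, Matrix.mul_apply, map_sum]
  have h2 : trPair N (P * M) = ∑ k, ∑ j, ∑ i, dClass (N k j) (P j i * M i k) := by
    simp only [trPair, Matrix.mul_apply, map_sum]
  have e1 : ∑ i, ∑ j, ∑ k, dClass (M i k) (N k j * P j i)
      = ∑ i, ∑ k, ∑ j, dClass (M i k) (N k j * P j i) :=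
    Finset.sum_congr rfl fun i _ => Finset.sum_comm
  have e2 : ∑ i, ∑ j, ∑ k, dClass (N k j) (P j i * M i k)
      = ∑ i, ∑ k, ∑ j, dClass (N k j) (P j i * M i k) :=
    Finset.sum_congr rfl fun i _ => Finset.sum_comm
  have e3 : ∑ i, ∑ k, ∑ j, dClass (N k j) (P j i * M i k)
      = ∑ k, ∑ i, ∑ j, dClass (N k j) (P j i * M i k) := Finset.sum_comm
  have e4 : ∑ k, ∑ i, ∑ j, dClass (N k j) (P j i * M i k)
      = ∑ k, ∑ j, ∑ i, dClass (N k j) (P j i * M i k) :=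
    Finset.sum_congr rfl fun i _ => Finset.sum_comm
  rw [hl, h1, h2, e1, e2, e3, e4]

theorem lieKA_trPair {n : ℕ} (D : Witt n) (M N : Matrix (Fin n) (Fin n) (Laurent n)) :
    lieKA D (trPair M N) = trPair (M.map D) N + trPair M (N.map D) := by
  simp [trPair, lieKA_dClass, Finset.sum_add_distrib]

/-- The Jacobian matrix `(dⱼ(uᵢ))ᵢⱼ` of `∑ uᵢ dᵢ`. -/
def jac {n : ℕ} (D : Witt n) : Matrix (Fin n) (Fin n) (Laurent n) :=
  Matrix.of fun i j => euler j (coef i D)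

theorem jac_lie {n : ℕ} (D E : Witt n) :
    jac ⁅D, E⁆ = (jac E).map D - (jac D).map E + (jac E * jac D - jac D * jac E) := by
  ext1 i j
  simp only [jac, Matrix.of_apply, coef_lie, map_sub, euler_apply_witt, Matrix.add_apply,
    Matrix.sub_apply, Matrix.map_apply, Matrix.mul_apply]
  abel

theorem jac_add {n : ℕ} (D E : Witt n) : jac (D + E) = jac D + jac E := by
  ext1 i j; simp [jac]

theorem jac_smul {n : ℕ} (c : ℂ) (D : Witt n) : jac (c • D) = c • jac D := by
  ext1 i j; simp [jac]

theorem phi₁_eq {n : ℕ} (D E : Witt n) : phi₁ D E = -trPair (jac D) (jac E) := rfl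

theorem phi₂_eq {n : ℕ} (D E : Witt n) :
    phi₂ D E = dClass (jac D).trace (jac E).trace := by
  simp only [phi₂, Matrix.trace, map_sum, LinearMap.sum_apply, Matrix.diag_apply, jac,
    Matrix.of_apply]
  exact Finset.sum_comm

theorem trace_jac_lie {n : ℕ} (D E : Witt n) :
    (jac ⁅D, E⁆).trace = D (jac E).trace - E (jac D).trace := by
  rw [jac_lie, Matrix.trace_add, Matrix.trace_sub, Matrix.trace_sub, Matrix.trace_mul_comm,
    sub_self, add_zero]
  simp [Matrix.trace]

/-- The linear combination `φ = c₁ φ₁ + c₂ φ₂`. -/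
def phi {n : ℕ} (c₁ c₂ : ℂ) (D E : Witt n) : KA n := c₁ • phi₁ D E + c₂ • phi₂ D E

theorem phi₁_swap {n : ℕ} (D E : Witt n) : phi₁ D E = -phi₁ E D := by
  rw [phi₁_eq, phi₁_eq, trPair_swap]

theorem phi₂_swap {n : ℕ} (D E : Witt n) : phi₂ D E = -phi₂ E D := by
  rw [phi₂_eq, phi₂_eq, dClass_swap]

theorem phi₁_cocycle {n : ℕ} (D E F : Witt n) :
    lieKA D (phi₁ E F) + phi₁ D ⁅E, F⁆
      = -lieKA F (phi₁ D E) + phi₁ ⁅D, E⁆ F + (lieKA E (phi₁ D F) + phi₁ E ⁅D, F⁆) := by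
  simp only [phi₁_eq, map_neg, lieKA_trPair, jac_lie, trPair_add_right, trPair_sub_right,
    trPair_add_left, trPair_sub_left, trPair_mul]
  rw [trPair_swap (jac E) ((jac D).map F)]
  abel

theorem phi₂_cocycle {n : ℕ} (D E F : Witt n) :
    lieKA D (phi₂ E F) + phi₂ D ⁅E, F⁆
      = -lieKA F (phi₂ D E) + phi₂ ⁅D, E⁆ F + (lieKA E (phi₂ D F) + phi₂ E ⁅D, F⁆) := by
  simp only [phi₂_eq, trace_jac_lie, lieKA_dClass, map_sub, LinearMap.sub_apply]
  have e1 := dClass_swap (E (jac D).trace) (jac F).trace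
  have e2 := dClass_swap (jac E).trace (F (jac D).trace)
  have e3 := dClass_swap (D (jac E).trace) (jac F).trace
  grind

theorem phi_swap {n : ℕ} (c₁ c₂ : ℂ) (D E : Witt n) : phi c₁ c₂ D E = -phi c₁ c₂ E D := by
  rw [phi, phi, phi₁_swap, phi₂_swap]
  module

theorem phi_cocycle {n : ℕ} (c₁ c₂ : ℂ) (D E F : Witt n) :
    lieKA D (phi c₁ c₂ E F) + phi c₁ c₂ D ⁅E, F⁆
      = -lieKA F (phi c₁ c₂ D E) + phi c₁ c₂ ⁅D, E⁆ F
        + (lieKA E (phi c₁ c₂ D F) + phi c₁ c₂ E ⁅D, F⁆) := by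
  simp only [phi, map_add, map_smul]
  have h1 := congrArg (c₁ • ·) (phi₁_cocycle D E F)
  have h2 := congrArg (c₂ • ·) (phi₂_cocycle D E F)
  simp only [smul_add, smul_neg] at h1 h2
  rw [add_add_add_comm, h1, h2]
  simp only [neg_add]
  abel

theorem phi_add_left {n : ℕ} (c₁ c₂ : ℂ) (D D' E : Witt n) :
    phi c₁ c₂ (D + D') E = phi c₁ c₂ D E + phi c₁ c₂ D' E := by
  simp only [phi, phi₁_eq, phi₂_eq, jac_add, trPair_add_left, Matrix.trace_add, map_add,
    LinearMap.add_apply]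
  module

theorem phi_smul_left {n : ℕ} (c₁ c₂ c : ℂ) (D E : Witt n) :
    phi c₁ c₂ (c • D) E = c • phi c₁ c₂ D E := by
  simp only [phi, phi₁_eq, phi₂_eq, jac_smul, trPair_smul_left, Matrix.trace_smul, map_smul,
    LinearMap.smul_apply]
  module

theorem phi_add_right {n : ℕ} (c₁ c₂ : ℂ) (D E E' : Witt n) :
    phi c₁ c₂ D (E + E') = phi c₁ c₂ D E + phi c₁ c₂ D E' := by
  rw [phi_swap, phi_add_left, phi_swap c₁ c₂ E, phi_swap c₁ c₂ E']
  abel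

theorem phi_smul_right {n : ℕ} (c₁ c₂ c : ℂ) (D E : Witt n) :
    phi c₁ c₂ D (c • E) = c • phi c₁ c₂ D E := by
  rw [phi_swap, phi_smul_left, phi_swap c₁ c₂ E, smul_neg, neg_neg]

/-! ### The full toroidal Lie algebra -/

section Loop

variable {n : ℕ} {𝔤 : Type*} [LieRing 𝔤] [LieAlgebra ℂ 𝔤]

/-- The extension of a derivation of `A` to `A ⊗ 𝔤`: `D(f ⊗ x) = D(f) ⊗ x`. -/
def derLoop (D : Witt n) : Laurent n ⊗[ℂ] 𝔤 →ₗ[ℂ] Laurent n ⊗[ℂ] 𝔤 :=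
  LinearMap.rTensor 𝔤 (D : Laurent n →ₗ[ℂ] Laurent n)

theorem derLoop_tmul (D : Witt n) (f : Laurent n) (x : 𝔤) :
    derLoop D (f ⊗ₜ[ℂ] x) = D f ⊗ₜ[ℂ] x := rfl

theorem derLoop_add (D E : Witt n) (X : Laurent n ⊗[ℂ] 𝔤) :
    derLoop (D + E) X = derLoop D X + derLoop E X := by
  induction X with
  | zero => simp
  | tmul f x => simp [derLoop_tmul, TensorProduct.add_tmul]
  | add X Y hX hY => simp only [map_add, hX, hY]; abel

theorem derLoop_smul (c : ℂ) (D : Witt n) (X : Laurent n ⊗[ℂ] 𝔤) :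
    derLoop (c • D) X = c • derLoop D X := by
  induction X with
  | zero => simp
  | tmul f x => simp [derLoop_tmul, TensorProduct.smul_tmul']
  | add X Y hX hY => simp only [map_add, hX, hY, smul_add]

theorem derLoop_commutator (D E : Witt n) (X : Laurent n ⊗[ℂ] 𝔤) :
    derLoop ⁅D, E⁆ X = derLoop D (derLoop E X) - derLoop E (derLoop D X) := by
  induction X with
  | zero => simp
  | tmul f x => simp [derLoop_tmul, Derivation.commutator_apply, TensorProduct.sub_tmul]
  | add X Y hX hY => simp only [map_add, hX, hY]; abel

theorem derLoop_lie (D : Witt n) (X Y : Laurent n ⊗[ℂ] 𝔤) :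
    derLoop D ⁅X, Y⁆ = ⁅derLoop D X, Y⁆ + ⁅X, derLoop D Y⁆ := by
  induction X with
  | zero => simp
  | add X X' hX hX' => simp only [add_lie, map_add, hX, hX']; abel
  | tmul f x =>
    induction Y with
    | zero => simp
    | add Y Y' hY hY' => simp only [lie_add, map_add, hY, hY']; abel
    | tmul g y =>
      simp only [derLoop_tmul, LieAlgebra.ExtendScalars.bracket_tmul, D.leibniz, smul_eq_mul,
        TensorProduct.add_tmul]
      rw [mul_comm g, add_comm]

variable (n 𝔤) in
/-- The 2-cocycle `(f ⊗ x, g ⊗ y) ↦ (x, y) [g df]` of the loop algebra, with `(-,-)` the Killing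
form; so `(t^a ⊗ x, t^b ⊗ y) ↦ (x, y) ∑ aᵢ t^(a+b) Kᵢ`. -/
def loopCocycle : Laurent n ⊗[ℂ] 𝔤 →ₗ[ℂ] Laurent n ⊗[ℂ] 𝔤 →ₗ[ℂ] KA n :=
  TensorProduct.curry
    (TensorProduct.lift (LinearMap.lsmul ℂ (KA n)) ∘ₗ
      TensorProduct.map (TensorProduct.lift (killingForm ℂ 𝔤)) (TensorProduct.lift dClass) ∘ₗ
      (TensorProduct.comm ℂ _ _).toLinearMap ∘ₗ
      (TensorProduct.tensorTensorTensorComm ℂ (Laurent n) 𝔤 (Laurent n) 𝔤).toLinearMap)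

theorem loopCocycle_tmul (f g : Laurent n) (x y : 𝔤) :
    loopCocycle n 𝔤 (f ⊗ₜ[ℂ] x) (g ⊗ₜ[ℂ] y) = killingForm ℂ 𝔤 x y • dClass f g := rfl

theorem loopCocycle_swap (X Y : Laurent n ⊗[ℂ] 𝔤) :
    loopCocycle n 𝔤 X Y = -loopCocycle n 𝔤 Y X := by
  induction X with
  | zero => simp
  | add X X' hX hX' => simp only [map_add, LinearMap.add_apply, hX, hX']; abel
  | tmul f x =>
    induction Y with
    | zero => simp
    | add Y Y' hY hY' => simp only [map_add, LinearMap.add_apply, hY, hY']; abel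
    | tmul g y =>
      rw [loopCocycle_tmul, loopCocycle_tmul, LieModule.traceForm_comm, dClass_swap f g, smul_neg]

theorem loopCocycle_lie (X Y Z : Laurent n ⊗[ℂ] 𝔤) :
    loopCocycle n 𝔤 X ⁅Y, Z⁆ = loopCocycle n 𝔤 ⁅X, Y⁆ Z + loopCocycle n 𝔤 Y ⁅X, Z⁆ := by
  induction X with
  | zero => simp
  | add X X' hX hX' => simp only [map_add, LinearMap.add_apply, add_lie, hX, hX']; abel
  | tmul f x =>
    induction Y with
    | zero => simp
    | add Y Y' hY hY' =>
      simp only [map_add, LinearMap.add_apply, add_lie, lie_add, hY, hY']; abel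
    | tmul g y =>
      induction Z with
      | zero => simp
      | add Z Z' hZ hZ' =>
        simp only [map_add, lie_add, hZ, hZ']; abel
      | tmul h z =>
        simp only [LieAlgebra.ExtendScalars.bracket_tmul, loopCocycle_tmul, dClass_mul]
        have h1 := LieModule.traceForm_apply_lie_apply ℂ 𝔤 𝔤 x y z
        have h2 := LieModule.traceForm_apply_lie_apply' ℂ 𝔤 𝔤 x y z
        have h3 : killingForm ℂ 𝔤 y ⁅x, z⁆ = -killingForm ℂ 𝔤 x ⁅y, z⁆ := by
          rw [← h1, h2, neg_neg]
        rw [h1, h3, mul_comm h f]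
        module

theorem lieKA_loopCocycle (D : Witt n) (X Y : Laurent n ⊗[ℂ] 𝔤) :
    lieKA D (loopCocycle n 𝔤 X Y)
      = loopCocycle n 𝔤 (derLoop D X) Y + loopCocycle n 𝔤 X (derLoop D Y) := by
  induction X with
  | zero => simp
  | add X X' hX hX' => simp only [map_add, LinearMap.add_apply, hX, hX']; abel
  | tmul f x =>
    induction Y with
    | zero => simp
    | add Y Y' hY hY' => simp only [map_add, hY, hY']; abel
    | tmul g y =>
      simp only [derLoop_tmul, loopCocycle_tmul, map_smul, lieKA_dClass, smul_add]

end Loop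

end FullToroidal

/-- The full toroidal Lie algebra `ℒ = 𝔤 ⊗ A ⊕ 𝒦_A ⊕ Der(A)` of `𝔤` in `n` variables, with
respect to the cocycle `φ = c₁ φ₁ + c₂ φ₂` (the tensor factors are written `A ⊗ 𝔤`). -/
@[ext]
structure FullToroidalAlgebra (c₁ c₂ : ℂ) (n : ℕ) (𝔤 : Type*) [LieRing 𝔤] [LieAlgebra ℂ 𝔤] where
  /-- the component in `A ⊗ 𝔤` -/
  loop : FullToroidal.Laurent n ⊗[ℂ] 𝔤
  /-- the component in `𝒦_A` -/
  cen : FullToroidal.KA n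
  /-- the component in `Der(A)` -/
  der : FullToroidal.Witt n

namespace FullToroidalAlgebra

open FullToroidal

section Algebra

variable {c₁ c₂ : ℂ} {n : ℕ} {𝔤 : Type*} [LieRing 𝔤] [LieAlgebra ℂ 𝔤]

variable (c₁ c₂ n 𝔤) in
/-- The underlying vector space is the direct sum of the three components. -/
def equivProd : FullToroidalAlgebra c₁ c₂ n 𝔤 ≃ (Laurent n ⊗[ℂ] 𝔤) × KA n × Witt n where
  toFun X := (X.loop, X.cen, X.der)
  invFun p := ⟨p.1, p.2.1, p.2.2⟩

instance : AddCommGroup (FullToroidalAlgebra c₁ c₂ n 𝔤) := (equivProd c₁ c₂ n 𝔤).addCommGroup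

instance : Module ℂ (FullToroidalAlgebra c₁ c₂ n 𝔤) := (equivProd c₁ c₂ n 𝔤).module ℂ

variable (X Y : FullToroidalAlgebra c₁ c₂ n 𝔤) (c : ℂ)

@[simp] theorem loop_zero : (0 : FullToroidalAlgebra c₁ c₂ n 𝔤).loop = 0 := rfl
@[simp] theorem cen_zero : (0 : FullToroidalAlgebra c₁ c₂ n 𝔤).cen = 0 := rfl
@[simp] theorem der_zero : (0 : FullToroidalAlgebra c₁ c₂ n 𝔤).der = 0 := rfl
@[simp] theorem loop_add : (X + Y).loop = X.loop + Y.loop := rfl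
@[simp] theorem cen_add : (X + Y).cen = X.cen + Y.cen := rfl
@[simp] theorem der_add : (X + Y).der = X.der + Y.der := rfl
@[simp] theorem loop_smul : (c • X).loop = c • X.loop := rfl
@[simp] theorem cen_smul : (c • X).cen = c • X.cen := rfl
@[simp] theorem der_smul : (c • X).der = c • X.der := rfl

/-- The bracket of `ℒ`. The parts in `𝔤 ⊗ A` and `𝒦_A` are acted on by `Der(A)`, the subspace
`𝒦_A` commutes with itself and with `𝔤 ⊗ A`. -/
instance : Bracket (FullToroidalAlgebra c₁ c₂ n 𝔤) (FullToroidalAlgebra c₁ c₂ n 𝔤) where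
  bracket X Y :=
    { loop := ⁅X.loop, Y.loop⁆ + derLoop X.der Y.loop - derLoop Y.der X.loop
      cen := loopCocycle n 𝔤 X.loop Y.loop + lieKA X.der Y.cen - lieKA Y.der X.cen
        + phi c₁ c₂ X.der Y.der
      der := ⁅X.der, Y.der⁆ }

theorem loop_lie : ⁅X, Y⁆.loop = ⁅X.loop, Y.loop⁆ + derLoop X.der Y.loop - derLoop Y.der X.loop :=
  rfl

theorem cen_lie : ⁅X, Y⁆.cen = loopCocycle n 𝔤 X.loop Y.loop + lieKA X.der Y.cen
    - lieKA Y.der X.cen + phi c₁ c₂ X.der Y.der := rfl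

theorem der_lie : ⁅X, Y⁆.der = ⁅X.der, Y.der⁆ := rfl

theorem self_zero {V : Type*} [AddCommGroup V] [Module ℂ V] {v : V} (h : v = -v) : v = 0 := by
  have h2 : (2 : ℂ) • v = 0 := by
    rw [two_smul]
    nth_rewrite 1 [h]
    exact neg_add_cancel v
  exact (smul_eq_zero.mp h2).resolve_left two_ne_zero

instance : LieRing (FullToroidalAlgebra c₁ c₂ n 𝔤) where
  add_lie X Y Z := by
    ext1
    · simp only [loop_lie, loop_add, der_add, add_lie, derLoop_add, map_add]; abel
    · simp only [cen_lie, loop_add, der_add, cen_add, lieKA_add, phi_add_left, map_add,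
        LinearMap.add_apply]; abel
    · simp only [der_lie, der_add, add_lie]
  lie_add X Y Z := by
    ext1
    · simp only [loop_lie, loop_add, der_add, lie_add, derLoop_add, map_add]; abel
    · simp only [cen_lie, loop_add, der_add, cen_add, lieKA_add, phi_add_right, map_add]; abel
    · simp only [der_lie, der_add, lie_add]
  lie_self X := by
    ext1
    · simp [loop_lie]
    · rw [cen_lie, self_zero (loopCocycle_swap X.loop X.loop),
        self_zero (phi_swap c₁ c₂ X.der X.der)]
      simp
    · simp [der_lie]
  leibniz_lie X Y Z := by
    ext1
    · simp only [loop_lie, loop_add, der_lie, derLoop_commutator, derLoop_lie, map_add, map_sub,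
        lie_add, lie_sub, add_lie, sub_lie]
      rw [leibniz_lie X.loop Y.loop Z.loop, ← lie_skew (derLoop Z.der X.loop) Y.loop]
      abel
    · simp only [cen_lie, cen_add, loop_lie, der_lie, lieKA_lie, map_add, map_sub,
        LinearMap.add_apply, LinearMap.sub_apply, lieKA_loopCocycle]
      have h1 := loopCocycle_lie X.loop Y.loop Z.loop
      have h2 := phi_cocycle c₁ c₂ X.der Y.der Z.der
      have h3 := loopCocycle_swap Y.loop (derLoop Z.der X.loop)
      rw [h1, h3]
      rw [← sub_eq_zero] at h2 ⊢
      rw [← h2]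
      abel
    · simp only [der_lie, der_add, leibniz_lie X.der]

instance : LieAlgebra ℂ (FullToroidalAlgebra c₁ c₂ n 𝔤) where
  lie_smul c X Y := by
    ext1
    · simp only [loop_lie, loop_smul, der_smul, lie_smul, derLoop_smul, map_smul, smul_add,
        smul_sub]
    · simp only [cen_lie, loop_smul, der_smul, cen_smul, lieKA_smul, phi_smul_right, map_smul,
        smul_add, smul_sub]
    · simp only [der_lie, der_smul, lie_smul]

variable (c₁ c₂ n) in
/-- The linear map `(x, (uᵢ)) ↦ x ⊗ 1 + ∑ uᵢ dᵢ` from `𝔥 ⊕ ℂⁿ` to `ℒ`. -/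
def cartanMap (𝔥 : LieSubalgebra ℂ 𝔤) :
    𝔥 × (Fin n → ℂ) →ₗ[ℂ] FullToroidalAlgebra c₁ c₂ n 𝔤 where
  toFun p := ⟨1 ⊗ₜ[ℂ] (p.1 : 𝔤), 0, ∑ i, p.2 i • euler i⟩
  map_add' p q := by
    ext1
    · simp [TensorProduct.tmul_add]
    · simp
    · simp [add_smul, Finset.sum_add_distrib]
  map_smul' c p := by
    ext1
    · simp
    · simp
    · simp [mul_smul, Finset.smul_sum]

theorem sum_euler_one (u : Fin n → ℂ) : (∑ i, u i • euler i : Witt n) 1 = 0 :=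
  Derivation.map_one_eq_zero _

theorem coef_sum_euler (u : Fin n → ℂ) (j : Fin n) :
    coef j (∑ i, u i • euler i : Witt n) = u j • (1 : Laurent n) := by
  have h : ∀ i, coef j (euler i : Witt n) = if i = j then 1 else 0 := fun i => by
    simpa using coef_smul_euler (1 : Laurent n) i j
  simp [h]

theorem jac_sum_euler (u : Fin n → ℂ) : jac (∑ i, u i • euler i : Witt n) = 0 := by
  ext1 i j
  simp only [jac, Matrix.of_apply, coef_sum_euler, Matrix.zero_apply]
  simp

theorem sum_euler_comm (u v : Fin n → ℂ) :
    ⁅(∑ i, u i • euler i : Witt n), (∑ i, v i • euler i : Witt n)⁆ = 0 := by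
  have h : ∀ i j : Fin n, ⁅(euler i : Witt n), (euler j : Witt n)⁆ = 0 := fun i j => by
    ext1 f
    simp [Derivation.commutator_apply, euler_comm i j]
  simp [sum_lie, lie_sum, h]

variable (c₁ c₂ n) in
/-- The subalgebra `𝔥̃ₙ = 𝔥 ⊕ D` of `ℒ`, where `𝔥 = 𝔥 ⊗ 1` and `D = ⨁ ℂ dᵢ`. -/
def cartan (𝔥 : LieSubalgebra ℂ 𝔤) : LieSubalgebra ℂ (FullToroidalAlgebra c₁ c₂ n 𝔤) where
  toSubmodule := LinearMap.range (cartanMap c₁ c₂ n 𝔥)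
  lie_mem' := by
    rintro _ _ ⟨⟨x, u⟩, rfl⟩ ⟨⟨y, v⟩, rfl⟩
    refine ⟨(⁅x, y⁆, 0), ?_⟩
    ext1
    · simp [cartanMap, loop_lie, derLoop_tmul]
    · simp [cartanMap, cen_lie, loopCocycle_tmul, phi, phi₁_eq, phi₂_eq, jac_sum_euler, trPair,
        dClass_one]
    · simp [cartanMap, der_lie, sum_euler_comm]

end Algebra

end FullToroidalAlgebra

/-! ### Modules that are free of rank one over the enveloping algebra of a subalgebra -/

section Free

attribute [local instance 100] LieRing.ofAssociativeRing

/-- The objects `M` of `ℳ(𝔞, 𝔟)`: the restriction of the `𝔞`-module `M` to `U(𝔟)` is isomorphic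
to the left regular module `U(𝔟)`. -/
def IsFreeOfRankOne {𝔞 : Type*} [LieRing 𝔞] [LieAlgebra ℂ 𝔞] (𝔟 : LieSubalgebra ℂ 𝔞)
    (M : Type*) [AddCommGroup M] [Module ℂ M] [LieRingModule 𝔞 M] [LieModule ℂ 𝔞 M] : Prop :=
  ∃ e : UniversalEnvelopingAlgebra ℂ 𝔟 ≃ₗ[ℂ] M, ∀ u v : UniversalEnvelopingAlgebra ℂ 𝔟,
    e (u * v) = UniversalEnvelopingAlgebra.lift ℂ (LieModule.toEnd ℂ 𝔟 M) u (e v)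

end Free

/-! ### The modules `M̂(Λ, a, M_𝔤)` -/

namespace FullToroidal

section Hat

open MvPolynomial

variable {n : ℕ}

/-- `τ^r : ℂ[d₁, …, dₙ] → ℂ[d₁, …, dₙ]`, `dⱼ ↦ dⱼ - rⱼ`. -/
def tau (r : Fin n → ℤ) : MvPolynomial (Fin n) ℂ →ₐ[ℂ] MvPolynomial (Fin n) ℂ :=
  aeval fun j => X j - C (r j : ℂ)

/-- `Λ^r = ∏ λⱼ^(rⱼ)`. -/
def lamPow (Λ : Fin n → ℂˣ) (r : Fin n → ℤ) : ℂ := ((∏ j, Λ j ^ r j : ℂˣ) : ℂ)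

theorem tau_zero : tau (0 : Fin n → ℤ) = AlgHom.id ℂ _ := by
  ext j; simp [tau]

theorem tau_add (r s : Fin n → ℤ) : tau (r + s) = (tau r).comp (tau s) := by
  apply MvPolynomial.algHom_ext
  intro j
  simp only [tau, aeval_X, AlgHom.comp_apply, map_sub, aeval_C, Pi.add_apply, Int.cast_add,
    C_add, MvPolynomial.algebraMap_eq]
  ring

theorem lamPow_zero (Λ : Fin n → ℂˣ) : lamPow Λ 0 = 1 := by simp [lamPow]

theorem lamPow_add (Λ : Fin n → ℂˣ) (r s : Fin n → ℤ) :
    lamPow Λ (r + s) = lamPow Λ r * lamPow Λ s := by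
  simp [lamPow, zpow_add, Finset.prod_mul_distrib]

/-- The action of `A` on `ℂ[d₁, …, dₙ]` with `t^r` acting as `Λ^r τ^r`. -/
def shift (Λ : Fin n → ℂˣ) : Laurent n →ₐ[ℂ] Module.End ℂ (MvPolynomial (Fin n) ℂ) :=
  AddMonoidAlgebra.lift ℂ (Module.End ℂ (MvPolynomial (Fin n) ℂ)) (Fin n → ℤ)
    { toFun := fun r => lamPow Λ r.toAdd • (tau r.toAdd).toLinearMap
      map_one' := by
        rw [toAdd_one, lamPow_zero, tau_zero, one_smul]
        rfl
      map_mul' := fun r s => by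
        rw [toAdd_mul, lamPow_add, tau_add]
        refine LinearMap.ext fun p => ?_
        simp only [LinearMap.smul_apply, AlgHom.toLinearMap_apply, AlgHom.comp_apply,
          Module.End.mul_apply, map_smul, mul_smul]
        rw [smul_comm] }

theorem shift_mono (Λ : Fin n → ℂˣ) (r : Fin n → ℤ) (p : MvPolynomial (Fin n) ℂ) :
    shift Λ (mono r) p = lamPow Λ r • tau r p := by
  have h : shift Λ (mono r) = (1 : ℂ) • (lamPow Λ r • (tau r).toLinearMap) :=
    AddMonoidAlgebra.lift_single _ r 1
  rw [h, one_smul]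
  rfl

/-- The action of the Witt algebra on `ℂ[d₁, …, dₙ]`: `∑ uᵢ dᵢ` acts as
`∑ᵢ (dᵢ · uᵢ(-) - (a + 1) dᵢ(uᵢ)(-))`, so `t^r dᵢ` acts as `p ↦ Λ^r τ^r(p) (dᵢ - rᵢ (a + 1))`. -/
def wittAct (Λ : Fin n → ℂˣ) (a : ℂ) : Witt n →ₗ[ℂ] Module.End ℂ (MvPolynomial (Fin n) ℂ) :=
  ∑ i, (LinearMap.mulLeft ℂ (LinearMap.mulLeft ℂ (X i : MvPolynomial (Fin n) ℂ)) ∘ₗ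
      (shift Λ).toLinearMap ∘ₗ coef i
    - (a + 1) • ((shift Λ).toLinearMap ∘ₗ (euler i : Laurent n →ₗ[ℂ] Laurent n) ∘ₗ coef i))

theorem wittAct_apply (Λ : Fin n → ℂˣ) (a : ℂ) (D : Witt n) (p : MvPolynomial (Fin n) ℂ) :
    wittAct Λ a D p = ∑ i, (X i * shift Λ (coef i D) p
      - (a + 1) • shift Λ (euler i (coef i D)) p) := by
  simp [wittAct, LinearMap.sum_apply]

theorem wittAct_mono_smul (Λ : Fin n → ℂˣ) (a : ℂ) (r : Fin n → ℤ) (i : Fin n)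
    (p : MvPolynomial (Fin n) ℂ) :
    wittAct Λ a (mono r • euler i) p
      = lamPow Λ r • (tau r p * (X i - C ((r i : ℂ) * (a + 1)))) := by
  rw [wittAct_apply, Finset.sum_eq_single i]
  · rw [coef_smul_euler, if_pos rfl, euler_mono, map_smul, LinearMap.smul_apply, shift_mono]
    simp only [MvPolynomial.smul_eq_C_mul, map_mul]
    ring
  · intro j _ hj
    rw [coef_smul_euler, if_neg (Ne.symm hj)]
    simp
  · simp

theorem shift_X_mul (Λ : Fin n → ℂˣ) (f : Laurent n) (i : Fin n)
    (p : MvPolynomial (Fin n) ℂ) :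
    shift Λ f (X i * p) = X i * shift Λ f p - shift Λ (euler i f) p := by
  induction f using laurent_induction with
  | ha f g hf hg => simp only [map_add, LinearMap.add_apply, hf, hg]; ring
  | hs c f hf =>
    simp only [map_smul, LinearMap.smul_apply, hf, Derivation.map_smul, smul_sub, mul_smul_comm]
  | hm r =>
    rw [euler_mono, map_smul, LinearMap.smul_apply]
    simp only [shift_mono, map_mul, MvPolynomial.smul_eq_C_mul]
    simp only [tau, aeval_X]
    ring

theorem wittAct_shift (Λ : Fin n → ℂˣ) (a : ℂ) (D : Witt n) (f : Laurent n)
    (p : MvPolynomial (Fin n) ℂ) :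
    wittAct Λ a D (shift Λ f p) = shift Λ f (wittAct Λ a D p) + shift Λ (D f) p := by
  have hc : ∀ (g h : Laurent n) (q : MvPolynomial (Fin n) ℂ),
      shift Λ g (shift Λ h q) = shift Λ (g * h) q := fun g h q => by
    rw [map_mul]; rfl
  rw [wittAct_apply, wittAct_apply, witt_apply D f, map_sum, map_sum, LinearMap.sum_apply,
    ← Finset.sum_add_distrib]
  refine Finset.sum_congr rfl fun i _ => ?_
  rw [map_sub, map_smul, shift_X_mul, hc, hc, hc, hc, hc, mul_comm f, mul_comm f,
    mul_comm (euler i f)]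
  abel

theorem coef_lie_euler (D : Witt n) (i j : Fin n) :
    coef i ⁅(euler j : Witt n), D⁆ = euler j (coef i D) := by
  rw [coef_lie]
  have h : coef i (euler j : Witt n) = if j = i then 1 else 0 := by
    simpa using coef_smul_euler (1 : Laurent n) j i
  rw [h]
  split_ifs <;> simp

theorem wittAct_X_mul (Λ : Fin n → ℂˣ) (a : ℂ) (D : Witt n) (j : Fin n)
    (p : MvPolynomial (Fin n) ℂ) :
    wittAct Λ a D (X j * p) = X j * wittAct Λ a D p - wittAct Λ a ⁅euler j, D⁆ p := by
  simp only [wittAct_apply, coef_lie_euler, shift_X_mul, Finset.mul_sum,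
    ← Finset.sum_sub_distrib]
  refine Finset.sum_congr rfl fun i _ => ?_
  rw [euler_comm j i]
  simp only [MvPolynomial.smul_eq_C_mul]
  ring

theorem wittAct_eq (Λ : Fin n → ℂˣ) (a : ℂ) (D : Witt n) (p : MvPolynomial (Fin n) ℂ) :
    wittAct Λ a D p = ∑ i, X i * shift Λ (coef i D) p
      - (a + 1) • shift Λ (jac D).trace p := by
  have h : (jac D).trace = ∑ i, euler i (coef i D) := rfl
  rw [wittAct_apply, h, map_sum, LinearMap.sum_apply, Finset.smul_sum, Finset.sum_sub_distrib]

theorem trace_jac_lie_euler (D : Witt n) (j : Fin n) :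
    (jac ⁅(euler j : Witt n), D⁆).trace = euler j (jac D).trace := by
  have h : ∀ E : Witt n, (jac E).trace = ∑ i, euler i (coef i E) := fun _ => rfl
  rw [h, h, map_sum]
  refine Finset.sum_congr rfl fun i _ => ?_
  rw [coef_lie_euler, euler_comm]

theorem wittAct_lie (Λ : Fin n → ℂˣ) (a : ℂ) (D E : Witt n) (p : MvPolynomial (Fin n) ℂ) :
    wittAct Λ a ⁅D, E⁆ p
      = wittAct Λ a D (wittAct Λ a E p) - wittAct Λ a E (wittAct Λ a D p) := by
  have hc : ∀ (g h : Laurent n) (q : MvPolynomial (Fin n) ℂ),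
      shift Λ g (shift Λ h q) = shift Λ (g * h) q := fun g h q => by
    rw [map_mul]; rfl
  have h1 : ∑ j, shift Λ (coef j E) (wittAct Λ a ⁅euler j, D⁆ p)
      = ∑ i, X i * shift Λ (E (coef i D)) p
        - ∑ j, shift Λ (⁅(euler j : Witt n), D⁆ (coef j E)) p
        - (a + 1) • shift Λ (E (jac D).trace) p := by
    have e1 : ∀ j, shift Λ (coef j E) (wittAct Λ a ⁅euler j, D⁆ p)
        = ∑ i, X i * shift Λ (coef j E * euler j (coef i D)) p
          - shift Λ (⁅(euler j : Witt n), D⁆ (coef j E)) p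
          - (a + 1) • shift Λ (coef j E * euler j (jac D).trace) p := fun j => by
      rw [wittAct_eq, trace_jac_lie_euler, map_sub, map_smul, hc, map_sum,
        witt_apply _ (coef j E), map_sum, LinearMap.sum_apply, ← Finset.sum_sub_distrib]
      congr 1
      refine Finset.sum_congr rfl fun i _ => ?_
      rw [coef_lie_euler, shift_X_mul, hc, hc, mul_comm (euler i (coef j E))]
    simp only [e1, Finset.sum_sub_distrib]
    congr 1
    · congr 1
      rw [Finset.sum_comm]
      refine Finset.sum_congr rfl fun i _ => ?_
      rw [witt_apply E (coef i D), map_sum, LinearMap.sum_apply, Finset.mul_sum]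
    · rw [witt_apply E (jac D).trace, map_sum, LinearMap.sum_apply, Finset.smul_sum]
  have h2 : wittAct Λ a D (wittAct Λ a E p)
      = ∑ j, X j * shift Λ (coef j E) (wittAct Λ a D p)
        + ∑ j, X j * shift Λ (D (coef j E)) p
        - (∑ j, shift Λ (coef j E) (wittAct Λ a ⁅euler j, D⁆ p)
          + ∑ j, shift Λ (⁅(euler j : Witt n), D⁆ (coef j E)) p)
        - (a + 1) • (shift Λ (jac E).trace (wittAct Λ a D p)
          + shift Λ (D (jac E).trace) p) := by
    rw [wittAct_eq Λ a E p, map_sub, map_smul, wittAct_shift, map_sum]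
    congr 1
    rw [← Finset.sum_add_distrib, ← Finset.sum_add_distrib, ← Finset.sum_sub_distrib]
    refine Finset.sum_congr rfl fun j _ => ?_
    rw [wittAct_X_mul, wittAct_shift, wittAct_shift, mul_add]
  have h3 : ∑ i, X i * shift Λ (coef i ⁅D, E⁆) p
      = ∑ i, X i * shift Λ (D (coef i E)) p - ∑ i, X i * shift Λ (E (coef i D)) p := by
    rw [← Finset.sum_sub_distrib]
    refine Finset.sum_congr rfl fun i _ => ?_
    rw [coef_lie, map_sub, LinearMap.sub_apply, mul_sub]
  rw [h2, h1, wittAct_eq Λ a E (wittAct Λ a D p), wittAct_eq Λ a ⁅D, E⁆ p, h3, trace_jac_lie,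
    map_sub, LinearMap.sub_apply, smul_add, smul_sub]
  abel

variable {𝔤 : Type*} [LieRing 𝔤] [LieAlgebra ℂ 𝔤]
variable (V : Type*) [AddCommGroup V] [Module ℂ V] [LieRingModule 𝔤 V] [LieModule ℂ 𝔤 V]

/-- The action of `A ⊗ 𝔤` on `V ⊗ ℂ[d₁, …, dₙ]`:
`(t^r ⊗ x) (v ⊗ p) = Λ^r (x v) ⊗ τ^r(p)`. -/
def loopAct (Λ : Fin n → ℂˣ) :
    Laurent n ⊗[ℂ] 𝔤 →ₗ[ℂ] Module.End ℂ (V ⊗[ℂ] MvPolynomial (Fin n) ℂ) :=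
  TensorProduct.lift
    (((TensorProduct.mapBilinear (RingHom.id ℂ) V (MvPolynomial (Fin n) ℂ) V
        (MvPolynomial (Fin n) ℂ)).flip ∘ₗ (shift Λ).toLinearMap).compl₂
      (LieModule.toEnd ℂ 𝔤 V : 𝔤 →ₗ[ℂ] Module.End ℂ V))

theorem loopAct_tmul (Λ : Fin n → ℂˣ) (f : Laurent n) (x : 𝔤) (v : V)
    (p : MvPolynomial (Fin n) ℂ) :
    loopAct V Λ (f ⊗ₜ[ℂ] x) (v ⊗ₜ[ℂ] p) = ⁅x, v⁆ ⊗ₜ[ℂ] shift Λ f p := rfl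

variable (c₁ c₂ : ℂ)

/-- The action of `ℒ` on `V ⊗ ℂ[d₁, …, dₙ]`: `A ⊗ 𝔤` acts by `loopAct`, `𝒦_A` by zero and
`Der(A)` by `wittAct` on the second factor. -/
def hatAct (Λ : Fin n → ℂˣ) (a : ℂ) :
    FullToroidalAlgebra c₁ c₂ n 𝔤 →ₗ[ℂ] Module.End ℂ (V ⊗[ℂ] MvPolynomial (Fin n) ℂ) where
  toFun X := loopAct V Λ X.loop + LinearMap.lTensor V (wittAct Λ a X.der)
  map_add' X Y := by
    simp only [FullToroidalAlgebra.loop_add, FullToroidalAlgebra.der_add, map_add,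
      LinearMap.lTensor_add]
    abel
  map_smul' c X := by
    simp only [FullToroidalAlgebra.loop_smul, FullToroidalAlgebra.der_smul, map_smul,
      LinearMap.lTensor_smul, RingHom.id_apply, smul_add]

theorem hatAct_apply (Λ : Fin n → ℂˣ) (a : ℂ) (X : FullToroidalAlgebra c₁ c₂ n 𝔤)
    (m : V ⊗[ℂ] MvPolynomial (Fin n) ℂ) :
    hatAct V c₁ c₂ Λ a X m
      = loopAct V Λ X.loop m + LinearMap.lTensor V (wittAct Λ a X.der) m := rfl

theorem loopAct_lie (Λ : Fin n → ℂˣ) (X Y : Laurent n ⊗[ℂ] 𝔤)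
    (m : V ⊗[ℂ] MvPolynomial (Fin n) ℂ) :
    loopAct V Λ ⁅X, Y⁆ m
      = loopAct V Λ X (loopAct V Λ Y m) - loopAct V Λ Y (loopAct V Λ X m) := by
  induction m with
  | zero => simp
  | add m m' hm hm' => simp only [map_add, hm, hm']; abel
  | tmul v p =>
    induction X with
    | zero => simp
    | add X X' hX hX' => simp only [map_add, LinearMap.add_apply, add_lie, hX, hX']; abel
    | tmul f x =>
      induction Y with
      | zero => simp
      | add Y Y' hY hY' => simp only [map_add, LinearMap.add_apply, lie_add, hY, hY']; abel
      | tmul g y =>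
        have hc : ∀ (g h : Laurent n) (q : MvPolynomial (Fin n) ℂ),
            shift Λ g (shift Λ h q) = shift Λ (g * h) q := fun g h q => by
          rw [map_mul]; rfl
        simp only [LieAlgebra.ExtendScalars.bracket_tmul, loopAct_tmul, hc, lie_lie,
          TensorProduct.sub_tmul]
        rw [mul_comm g f]

theorem wittAct_loopAct (Λ : Fin n → ℂˣ) (a : ℂ) (D : Witt n) (X : Laurent n ⊗[ℂ] 𝔤)
    (m : V ⊗[ℂ] MvPolynomial (Fin n) ℂ) :
    LinearMap.lTensor V (wittAct Λ a D) (loopAct V Λ X m)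
      = loopAct V Λ X (LinearMap.lTensor V (wittAct Λ a D) m) + loopAct V Λ (derLoop D X) m := by
  induction m with
  | zero => simp
  | add m m' hm hm' => simp only [map_add, hm, hm']; abel
  | tmul v p =>
    induction X with
    | zero => simp
    | add X X' hX hX' => simp only [map_add, LinearMap.add_apply, hX, hX']; abel
    | tmul f x =>
      simp only [derLoop_tmul, loopAct_tmul, LinearMap.lTensor_tmul, wittAct_shift,
        TensorProduct.tmul_add]

theorem lTensor_wittAct_lie (Λ : Fin n → ℂˣ) (a : ℂ) (D E : Witt n)
    (m : V ⊗[ℂ] MvPolynomial (Fin n) ℂ) :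
    LinearMap.lTensor V (wittAct Λ a ⁅D, E⁆) m
      = LinearMap.lTensor V (wittAct Λ a D) (LinearMap.lTensor V (wittAct Λ a E) m)
        - LinearMap.lTensor V (wittAct Λ a E) (LinearMap.lTensor V (wittAct Λ a D) m) := by
  induction m with
  | zero => simp
  | add m m' hm hm' => simp only [map_add, hm, hm']; abel
  | tmul v p =>
    simp only [LinearMap.lTensor_tmul, wittAct_lie, TensorProduct.tmul_sub]

theorem hatAct_lie (Λ : Fin n → ℂˣ) (a : ℂ) (X Y : FullToroidalAlgebra c₁ c₂ n 𝔤)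
    (m : V ⊗[ℂ] MvPolynomial (Fin n) ℂ) :
    hatAct V c₁ c₂ Λ a ⁅X, Y⁆ m
      = hatAct V c₁ c₂ Λ a X (hatAct V c₁ c₂ Λ a Y m)
        - hatAct V c₁ c₂ Λ a Y (hatAct V c₁ c₂ Λ a X m) := by
  simp only [hatAct_apply, FullToroidalAlgebra.loop_lie, FullToroidalAlgebra.der_lie, map_add,
    map_sub, LinearMap.add_apply, LinearMap.sub_apply, loopAct_lie, lTensor_wittAct_lie,
    wittAct_loopAct]
  abel

end Hat

end FullToroidal

/-- The vector space `V ⊗ ℂ[d₁, …, dₙ]` underlying `M̂(Λ, a, V)`. If `V = U(𝔥)` as an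
`𝔥`-module, then this is `U(𝔥) ⊗ ℂ[d₁, …, dₙ] = U(𝔥̃ₙ)`. -/
@[nolint unusedArguments]
def HatModule {n : ℕ} (_Λ : Fin n → ℂˣ) (_a : ℂ) (V : Type*) [AddCommGroup V] [Module ℂ V] :
    Type _ := V ⊗[ℂ] MvPolynomial (Fin n) ℂ

namespace HatModule

open FullToroidal

variable {n : ℕ} (Λ : Fin n → ℂˣ) (a : ℂ) (V : Type*) [AddCommGroup V] [Module ℂ V]

instance : AddCommGroup (HatModule Λ a V) :=
  inferInstanceAs (AddCommGroup (V ⊗[ℂ] MvPolynomial (Fin n) ℂ))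

instance : Module ℂ (HatModule Λ a V) :=
  inferInstanceAs (Module ℂ (V ⊗[ℂ] MvPolynomial (Fin n) ℂ))

variable {V} in
/-- The element `v ⊗ p`. -/
def tmul (v : V) (p : MvPolynomial (Fin n) ℂ) : HatModule Λ a V := v ⊗ₜ[ℂ] p

variable {𝔤 : Type*} [LieRing 𝔤] [LieAlgebra ℂ 𝔤] [LieRingModule 𝔤 V] [LieModule ℂ 𝔤 V]
variable {c₁ c₂ : ℂ}

instance : LieRingModule (FullToroidalAlgebra c₁ c₂ n 𝔤) (HatModule Λ a V) where
  bracket X m := hatAct V c₁ c₂ Λ a X m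
  add_lie X Y m := by
    change hatAct V c₁ c₂ Λ a (X + Y) m = _
    rw [map_add]
    rfl
  lie_add X m m' := map_add (hatAct V c₁ c₂ Λ a X) m m'
  leibniz_lie X Y m := sub_eq_iff_eq_add.mp (hatAct_lie V c₁ c₂ Λ a X Y m).symm

instance : LieModule ℂ (FullToroidalAlgebra c₁ c₂ n 𝔤) (HatModule Λ a V) where
  smul_lie c X m := by
    change hatAct V c₁ c₂ Λ a (c • X) m = _
    rw [map_smul]
    rfl
  lie_smul c X m := map_smul (hatAct V c₁ c₂ Λ a X) c m

theorem lie_loop (r : Fin n → ℤ) (x : 𝔤) (v : V) (p : MvPolynomial (Fin n) ℂ) :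
    ⁅(⟨mono r ⊗ₜ[ℂ] x, 0, 0⟩ : FullToroidalAlgebra c₁ c₂ n 𝔤), tmul Λ a v p⁆
      = lamPow Λ r • tmul Λ a ⁅x, v⁆ (tau r p) := by
  change loopAct V Λ (mono r ⊗ₜ[ℂ] x) (v ⊗ₜ[ℂ] p)
    + LinearMap.lTensor V (wittAct Λ a 0) (v ⊗ₜ[ℂ] p) = lamPow Λ r • (⁅x, v⁆ ⊗ₜ[ℂ] tau r p)
  rw [loopAct_tmul, shift_mono, map_zero, LinearMap.lTensor_zero, LinearMap.zero_apply, add_zero,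
    TensorProduct.tmul_smul]

theorem lie_cen (k : KA n) (m : HatModule Λ a V) :
    ⁅(⟨0, k, 0⟩ : FullToroidalAlgebra c₁ c₂ n 𝔤), m⁆ = 0 := by
  change loopAct (𝔤 := 𝔤) V Λ 0 m + LinearMap.lTensor V (wittAct Λ a 0) m = (0 : HatModule Λ a V)
  rw [map_zero, map_zero, LinearMap.lTensor_zero]
  exact add_zero _

theorem lie_witt (r : Fin n → ℤ) (i : Fin n) (v : V) (p : MvPolynomial (Fin n) ℂ) :
    ⁅(⟨0, 0, mono r • euler i⟩ : FullToroidalAlgebra c₁ c₂ n 𝔤), tmul Λ a v p⁆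
      = lamPow Λ r • tmul Λ a v
          (tau r p * (MvPolynomial.X i - MvPolynomial.C ((r i : ℂ) * (a + 1)))) := by
  change loopAct (𝔤 := 𝔤) V Λ 0 (v ⊗ₜ[ℂ] p)
    + LinearMap.lTensor V (wittAct Λ a (mono r • euler i)) (v ⊗ₜ[ℂ] p)
    = lamPow Λ r • (v ⊗ₜ[ℂ] _)
  rw [map_zero, LinearMap.zero_apply, zero_add, LinearMap.lTensor_tmul, wittAct_mono_smul,
    TensorProduct.tmul_smul]

end HatModule

end

/-!
In coordinates, a module that is free of rank one over `U(𝔥̃ₙ)` is the polynomial algebra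
`ℂ[𝔥*][d₁, …, dₙ]`, with `𝔥̃ₙ` acting by multiplication. Commuting with `dⱼ` and `𝔥`, the elements
`t^r dᵢ` and `h(r)`, for `h ∈ 𝔥`, act as the shift `dⱼ ↦ dⱼ - rⱼ` followed by multiplication by
polynomials `g r i` and `p r`. Fix `h` with `(h, h) ≠ 0`. Comparing degrees and leading coefficients
along the direction `r` in the brackets of these elements gives `p r = χ r · h` and
`g r i = χ r · (dᵢ - β r i)` for a character `χ` of `ℤⁿ`, that is, `χ r = Λ^r`. Then `h(r)` and
`h(s)` commute, so `[h(r), h(s)] = (h, h) ∑ᵢ rᵢ t^(r+s) Kᵢ` shows that `𝒦_A` acts by zero, and the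
Witt relations without cocycle force `β r i = rᵢ b` for some `b ∈ ℂ[𝔥*]`.

Since `𝔤` commutes with the operators `t^(±eᵢ) dᵢ`, it commutes with `b - b²`. A root vector acts
semilinearly over translation by its root, so `b - b²` is invariant under translation by the roots,
which span `𝔥*`. Hence `b` is a scalar, written `a + 1`. Finally `𝔤 ⊗ 1` preserves `ℂ[𝔥*]`, which
becomes `M_𝔤`, and `x(r)` is `Λ^r x(0)` followed by the shift.
-/

noncomputable section

namespace FullToroidal

section Enveloping

open MvPolynomial

variable {K L ι : Type*} [CommRing K]

/-- The linear form on `L*` defined by an element of the module `L`, as a polynomial in the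
coordinates with respect to a basis of `L`. -/
def linearPoly [AddCommGroup L] [Module K L] (b : Module.Basis ι K L) : L →ₗ[K] MvPolynomial ι K :=
  b.constr K X

theorem linearPoly_basis [AddCommGroup L] [Module K L] (b : Module.Basis ι K L) (k : ι) :
    linearPoly b (b k) = X k :=
  b.constr_basis K X k

theorem linearPoly_injective [AddCommGroup L] [Module K L] (b : Module.Basis ι K L) :
    Function.Injective (linearPoly b) := by
  have h : ⇑(linearPoly b) = Finsupp.linearCombination K X ∘ b.repr :=
    funext fun x => b.constr_apply K X x
  rw [h]
  exact Function.Injective.comp (linearIndependent_X ι K) b.repr.injective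

attribute [local instance 100] LieRing.ofAssociativeRing

variable [LieRing L] [LieAlgebra K L]

theorem adjoin_range_ι :
    Algebra.adjoin K (Set.range (UniversalEnvelopingAlgebra.ι K (L := L))) = ⊤ := by
  set S := Algebra.adjoin K (Set.range (UniversalEnvelopingAlgebra.ι K (L := L)))
  let f : L →ₗ⁅K⁆ S :=
    { toFun := fun x => ⟨UniversalEnvelopingAlgebra.ι K x, Algebra.subset_adjoin ⟨x, rfl⟩⟩
      map_add' := fun x y => Subtype.ext (map_add _ x y)
      map_smul' := fun c x => Subtype.ext (map_smul _ c x)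
      map_lie' := fun {x y} => Subtype.ext (LieHom.map_lie _ x y) }
  have hf : S.val.comp (UniversalEnvelopingAlgebra.lift K f) = AlgHom.id K _ := by
    ext x
    exact congrArg S.val (UniversalEnvelopingAlgebra.lift_ι_apply K f x)
  refine eq_top_iff.mpr fun u _ => ?_
  rw [← AlgHom.id_apply (R := K) u, ← hf]
  exact (UniversalEnvelopingAlgebra.lift K f u).2

theorem enveloping_mul_comm [IsLieAbelian L] (u v : UniversalEnvelopingAlgebra K L) :
    u * v = v * u := by
  have hι : ∀ x y : L, Commute (UniversalEnvelopingAlgebra.ι K x)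
      (UniversalEnvelopingAlgebra.ι K y) := fun x y => by
    rw [commute_iff_lie_eq, ← LieHom.map_lie, trivial_lie_zero, map_zero]
  have hmem : ∀ w : UniversalEnvelopingAlgebra K L,
      w ∈ Algebra.adjoin K (Set.range (UniversalEnvelopingAlgebra.ι K (L := L))) := fun w => by
    rw [adjoin_range_ι]
    exact Algebra.mem_top
  refine Algebra.commute_of_mem_adjoin_of_forall_mem_commute (hmem v) ?_
  rintro _ ⟨y, rfl⟩
  refine (Algebra.commute_of_mem_adjoin_of_forall_mem_commute (hmem u) ?_).symm
  rintro _ ⟨x, rfl⟩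
  exact hι y x

theorem exists_enveloping_algEquiv_mvPolynomial [IsLieAbelian L] (b : Module.Basis ι K L) :
    ∃ e : UniversalEnvelopingAlgebra K L ≃ₐ[K] MvPolynomial ι K,
      ∀ x, e (UniversalEnvelopingAlgebra.ι K x) = linearPoly b x := by
  let _ : CommRing (UniversalEnvelopingAlgebra K L) :=
    { (inferInstance : Ring (UniversalEnvelopingAlgebra K L)) with
      mul_comm := enveloping_mul_comm }
  let f : L →ₗ⁅K⁆ MvPolynomial ι K :=
    { linearPoly b with
      map_lie' := fun {x y} => by
        rw [trivial_lie_zero, LieRing.of_associative_ring_bracket, mul_comm, sub_self]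
        exact map_zero (linearPoly b) }
  let g : MvPolynomial ι K →ₐ[K] UniversalEnvelopingAlgebra K L :=
    aeval fun k => UniversalEnvelopingAlgebra.ι K (b k)
  have hgf : g.toLinearMap ∘ₗ linearPoly b
      = (UniversalEnvelopingAlgebra.ι K : L →ₗ⁅K⁆ UniversalEnvelopingAlgebra K L) :=
    b.ext fun k => by
      simp only [LinearMap.comp_apply, linearPoly_basis]
      exact aeval_X _ k
  refine ⟨AlgEquiv.ofAlgHom (UniversalEnvelopingAlgebra.lift K f) g ?_ ?_,
    fun x => UniversalEnvelopingAlgebra.lift_ι_apply K f x⟩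
  · refine algHom_ext fun k => ?_
    rw [AlgHom.comp_apply, aeval_X, UniversalEnvelopingAlgebra.lift_ι_apply]
    exact linearPoly_basis b k
  · ext x
    change g (UniversalEnvelopingAlgebra.lift K f (UniversalEnvelopingAlgebra.ι K x)) = _
    rw [UniversalEnvelopingAlgebra.lift_ι_apply]
    exact DFunLike.congr_fun hgf x

theorem isFreeOfRankOne_iff {𝔞 M : Type*} [LieRing 𝔞] [LieAlgebra ℂ 𝔞] {𝔟 : LieSubalgebra ℂ 𝔞}
    [IsLieAbelian 𝔟] [AddCommGroup M] [Module ℂ M] [LieRingModule 𝔞 M] [LieModule ℂ 𝔞 M]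
    (b : Module.Basis ι ℂ 𝔟) :
    IsFreeOfRankOne 𝔟 M ↔ ∃ E : MvPolynomial ι ℂ ≃ₗ[ℂ] M, ∀ (x : 𝔟) (f : MvPolynomial ι ℂ),
      E (linearPoly b x * f) = ⁅(x : 𝔞), E f⁆ := by
  obtain ⟨e, he⟩ := exists_enveloping_algEquiv_mvPolynomial b
  constructor
  · rintro ⟨E, hE⟩
    refine ⟨e.symm.toLinearEquiv.trans E, fun x f => ?_⟩
    change E (e.symm (linearPoly b x * f)) = ⁅(x : 𝔞), E (e.symm f)⁆
    rw [map_mul, ← he, AlgEquiv.symm_apply_apply, hE, UniversalEnvelopingAlgebra.lift_ι_apply]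
    rfl
  · rintro ⟨E, hE⟩
    have hact : UniversalEnvelopingAlgebra.lift ℂ (LieModule.toEnd ℂ 𝔟 M)
        = (E.conjAlgEquiv ℂ).toAlgHom.comp
          ((Algebra.lmul ℂ (MvPolynomial ι ℂ)).comp e.toAlgHom) := by
      ext x m
      change UniversalEnvelopingAlgebra.lift ℂ (LieModule.toEnd ℂ 𝔟 M)
        (UniversalEnvelopingAlgebra.ι ℂ x) m
          = E (e (UniversalEnvelopingAlgebra.ι ℂ x) * E.symm m)
      rw [UniversalEnvelopingAlgebra.lift_ι_apply, he, hE, LinearEquiv.apply_symm_apply]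
      rfl
    refine ⟨e.toLinearEquiv.trans E, fun u v => ?_⟩
    rw [hact]
    change E (e (u * v)) = E (e u * E.symm (E (e v)))
    rw [map_mul, LinearEquiv.symm_apply_apply]

end Enveloping

section FiniteDifference

open Polynomial

variable {S : Type*} [CommRing S]

theorem coeff_taylor_sub_self (a : S) {F : S[X]} {m : ℕ} (hm : F.natDegree ≤ m + 1) :
    (taylor a F - F).coeff m = (m + 1) * a * F.coeff (m + 1) := by
  have hd : (hasseDeriv m F).natDegree ≤ 1 := (natDegree_hasseDeriv_le F m).trans (by omega)
  rw [coeff_sub, taylor_coeff, eq_X_add_C_of_natDegree_le_one hd]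
  simp only [hasseDeriv_coeff, eval_add, eval_mul, eval_C, eval_X, zero_add, Nat.choose_self,
    Nat.cast_one, one_mul, add_comm 1 m, Nat.choose_succ_self_right]
  push_cast
  ring

theorem natDegree_taylor_sub_self_le (a : S) (F : S[X]) :
    (taylor a F - F).natDegree ≤ F.natDegree - 1 := by
  refine natDegree_le_iff_coeff_eq_zero.mpr fun N hN => ?_
  rcases (show F.natDegree ≤ N by omega).eq_or_lt with rfl | hlt
  · rw [coeff_sub, coeff_taylor_natDegree, leadingCoeff, sub_self]
  · rw [coeff_sub, coeff_eq_zero_of_natDegree_lt hlt,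
      coeff_eq_zero_of_natDegree_lt ((natDegree_taylor F a).trans_lt hlt), sub_zero]

variable [IsDomain S] [CharZero S]

theorem coeff_taylor_sub_self_ne_zero {a : S} (ha : a ≠ 0) {F : S[X]} {m : ℕ}
    (hm : F.natDegree = m + 1) : (taylor a F - F).coeff m ≠ 0 := by
  have hF : F.coeff (m + 1) ≠ 0 := by
    rw [← hm, coeff_natDegree, leadingCoeff_ne_zero]
    rintro rfl
    exact (Nat.succ_ne_zero m).symm hm
  rw [coeff_taylor_sub_self a hm.le]
  exact mul_ne_zero (mul_ne_zero (Nat.cast_add_one_ne_zero m) ha) hF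

theorem natDegree_eq_zero_of_taylor_eq_self {a : S} (ha : a ≠ 0) {F : S[X]}
    (h : taylor a F = F) : F.natDegree = 0 := by
  by_contra hF
  obtain ⟨m, hm⟩ := Nat.exists_eq_succ_of_ne_zero hF
  exact coeff_taylor_sub_self_ne_zero ha hm (by rw [h, sub_self, coeff_zero])

theorem natDegree_eq_of_taylor_sub_self_eq {a : S} (ha : a ≠ 0) {F D : S[X]} (hD : D ≠ 0)
    (h : taylor a F - F = D) :
    F.natDegree = D.natDegree + 1 ∧
      D.leadingCoeff = (D.natDegree + 1) * a * F.leadingCoeff := by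
  have hF : F.natDegree ≠ 0 := fun h0 => hD <| by
    rw [← h, eq_C_of_natDegree_eq_zero h0, taylor_C, sub_self]
  obtain ⟨m, hm⟩ := Nat.exists_eq_succ_of_ne_zero hF
  have hDm : D.natDegree = m := by
    refine le_antisymm ?_ (le_natDegree_of_ne_zero (h ▸ coeff_taylor_sub_self_ne_zero ha hm))
    simpa [h, hm] using natDegree_taylor_sub_self_le a F
  refine ⟨hDm ▸ hm, ?_⟩
  rw [leadingCoeff, leadingCoeff, hDm, ← h, coeff_taylor_sub_self a hm.le, hm]

theorem natDegree_add_eq_of_mul_taylor_sub {a : S} (ha : a ≠ 0) {P G D : S[X]} (hD : D ≠ 0)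
    (h : P * taylor a G - taylor (-a) P * G = D) :
    P.natDegree + G.natDegree = D.natDegree + 1 ∧
      D.leadingCoeff = (D.natDegree + 1) * a * (P.leadingCoeff * G.leadingCoeff) := by
  -- The product `taylor (-a) P * G` has the degree and leading coefficient of `P * G`.
  have hdiff : taylor a (taylor (-a) P * G) - taylor (-a) P * G = D := by
    rw [taylor_mul, taylor_taylor, add_neg_cancel, taylor_zero, h]
  obtain ⟨hdeg, hlead⟩ := natDegree_eq_of_taylor_sub_self_eq ha hD hdiff
  have hne : taylor (-a) P * G ≠ 0 := by
    intro h0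
    rw [h0, natDegree_zero] at hdeg
    omega
  rw [natDegree_mul (left_ne_zero_of_mul hne) (right_ne_zero_of_mul hne),
    natDegree_taylor] at hdeg
  rw [leadingCoeff_mul, leadingCoeff_taylor] at hlead
  exact ⟨hdeg, hlead⟩

end FiniteDifference

section Translation

open MvPolynomial

variable {σ R : Type*} [CommRing R]

/-- The translation `p(d) ↦ p(d - v)` of polynomials. -/
def translate (v : σ → R) : MvPolynomial σ R →ₐ[R] MvPolynomial σ R :=
  aeval fun j => X j - C (v j)

/-- The expansion `p(d + T v)` of a polynomial `p` along the line in the direction `v`, as a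
polynomial in `T`. -/
def along (v : σ → R) : MvPolynomial σ R →ₐ[R] Polynomial (MvPolynomial σ R) :=
  aeval fun j => Polynomial.C (X j) + Polynomial.C (C (v j)) * Polynomial.X

theorem translate_X (v : σ → R) (j : σ) : translate v (X j) = X j - C (v j) := aeval_X _ j

theorem translate_C (v : σ → R) (c : R) : translate v (C c) = C c := (translate v).commutes c

theorem along_X (v : σ → R) (j : σ) :
    along v (X j) = Polynomial.C (X j) + Polynomial.C (C (v j)) * Polynomial.X := aeval_X _ j

theorem along_C (v : σ → R) (c : R) : along v (C c) = Polynomial.C (C c) := (along v).commutes c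

theorem translate_zero (p : MvPolynomial σ R) : translate (0 : σ → R) p = p := by
  have h : translate (0 : σ → R) = AlgHom.id R _ := algHom_ext fun j => by simp [translate_X]
  rw [h, AlgHom.id_apply]

theorem translate_translate (v w : σ → R) (p : MvPolynomial σ R) :
    translate v (translate w p) = translate (v + w) p := by
  have h : (translate v).comp (translate w) = translate (v + w) := algHom_ext fun j => by
    simp only [AlgHom.comp_apply, translate_X, map_sub, translate_C, Pi.add_apply, C_add]
    ring
  exact DFunLike.congr_fun h p

theorem eval_translate (u v : σ → R) (p : MvPolynomial σ R) :
    eval u (translate v p) = eval (u - v) p := by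
  have h : (aeval u).comp (translate v) = aeval (u - v) := algHom_ext fun j => by
    simp [translate_X]
  exact DFunLike.congr_fun h p

theorem eval_zero_along (v : σ → R) (p : MvPolynomial σ R) : (along v p).eval 0 = p := by
  have h : ((Polynomial.aeval (0 : MvPolynomial σ R)).restrictScalars R).comp (along v)
      = AlgHom.id R _ := algHom_ext fun j => by simp [along_X]
  have hp := DFunLike.congr_fun h p
  rwa [AlgHom.comp_apply, AlgHom.restrictScalars_apply, Polynomial.coe_aeval_eq_eval] at hp

theorem along_injective (v : σ → R) : Function.Injective (along v) :=
  Function.LeftInverse.injective (eval_zero_along v)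

theorem along_translate_smul (c : R) (v : σ → R) (p : MvPolynomial σ R) :
    along v (translate (c • v) p) = Polynomial.taylor (-C c) (along v p) := by
  have h : (along v).comp (translate (c • v))
      = ((Polynomial.taylorAlgHom (-C c : MvPolynomial σ R)).restrictScalars R).comp (along v) :=
    algHom_ext fun j => by
      simp only [AlgHom.comp_apply, AlgHom.restrictScalars_apply, Polynomial.taylorAlgHom_apply,
        translate_X, along_X, along_C, map_sub, map_add, Polynomial.taylor_X,
        Polynomial.taylor_C, Pi.smul_apply, smul_eq_mul, map_mul, map_neg]
      ring
  exact DFunLike.congr_fun h p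

theorem along_eq_C_of_natDegree_eq_zero {v : σ → R} {p : MvPolynomial σ R}
    (h : (along v p).natDegree = 0) : along v p = Polynomial.C p := by
  have hC := Polynomial.eq_C_of_natDegree_eq_zero h
  rwa [Polynomial.coeff_zero_eq_eval_zero, eval_zero_along] at hC

variable [IsDomain R] [CharZero R]

theorem along_eq_C_of_translate_eq_self {v : σ → R} {p : MvPolynomial σ R}
    (h : translate v p = p) : along v p = Polynomial.C p := by
  refine along_eq_C_of_natDegree_eq_zero
    (natDegree_eq_zero_of_taylor_eq_self (neg_ne_zero.mpr (one_ne_zero (α := MvPolynomial σ R))) ?_)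
  rw [← C_1, ← along_translate_smul, one_smul, h]

/-- The submodule of the vectors by which a polynomial can be translated without change. -/
def periods (p : MvPolynomial σ R) : Submodule R (σ → R) where
  carrier := {v | translate v p = p}
  add_mem' {v w} hv hw := by
    change translate (v + w) p = p
    rw [← translate_translate, hw, hv]
  zero_mem' := translate_zero p
  smul_mem' c v hv := along_injective v <| by
    rw [along_translate_smul, along_eq_C_of_translate_eq_self hv, Polynomial.taylor_C]

theorem eq_C_of_translate_eq_self {p : MvPolynomial σ R} {s : Set (σ → R)}
    (hs : Submodule.span R s = ⊤) (h : ∀ v ∈ s, translate v p = p) :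
    p = C (constantCoeff p) := by
  have hperiods : ∀ v, translate v p = p := fun v =>
    (hs.symm.le.trans (Submodule.span_le.mpr h : _ ≤ periods p)) (Submodule.mem_top (x := v))
  refine funext fun u => ?_
  calc eval u p = eval u (translate u p) := by rw [hperiods]
    _ = eval u (C (constantCoeff p)) := by rw [eval_translate, sub_self, eval_zero, eval_C]

end Translation

section Shift

open MvPolynomial

variable {σ R : Type*} [CommRing R]

/-- The vector with entries in `R` of an integer vector. -/
def intVec (R : Type*) [Ring R] (r : σ → ℤ) : σ → R := fun j => r j

/-- The shift `p(d) ↦ p(d - r)` by an integer vector `r`, over any ring of coefficients. -/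
def shiftBy (r : σ → ℤ) : MvPolynomial σ R →ₐ[R] MvPolynomial σ R := translate (intVec R r)

theorem shiftBy_X (r : σ → ℤ) (j : σ) :
    shiftBy r (X j : MvPolynomial σ R) = X j - (r j : MvPolynomial σ R) := by
  rw [shiftBy, translate_X, intVec, map_intCast]

theorem shiftBy_C (r : σ → ℤ) (c : R) : shiftBy r (C c) = C c := translate_C _ c

theorem shiftBy_zero (p : MvPolynomial σ R) : shiftBy 0 p = p := by
  have h : intVec R (0 : σ → ℤ) = 0 := funext fun _ => Int.cast_zero
  rw [shiftBy, h, translate_zero]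

theorem shiftBy_shiftBy (r s : σ → ℤ) (p : MvPolynomial σ R) :
    shiftBy r (shiftBy s p) = shiftBy (r + s) p := by
  have h : intVec R (r + s) = intVec R r + intVec R s := funext fun _ => Int.cast_add _ _
  rw [shiftBy, shiftBy, shiftBy, translate_translate, h]

theorem along_shiftBy_zsmul (m : ℤ) (v : σ → ℤ) (p : MvPolynomial σ R) :
    along (intVec R v) (shiftBy (m • v) p)
      = Polynomial.taylor (-(m : MvPolynomial σ R)) (along (intVec R v) p) := by
  have h : intVec R (m • v) = (m : R) • intVec R v := funext fun j => by simp [intVec]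
  rw [shiftBy, h, along_translate_smul, map_intCast]

theorem span_range_intVec [Finite σ] :
    Submodule.span R (Set.range (intVec R : (σ → ℤ) → σ → R)) = ⊤ := by
  classical
  rw [eq_top_iff, ← (Pi.basisFun R σ).span_eq, Submodule.span_le]
  rintro _ ⟨j, rfl⟩
  refine Submodule.subset_span ⟨Pi.single j 1, funext fun k => ?_⟩
  rw [Pi.basisFun_apply, intVec, Pi.single_apply, Pi.single_apply]
  split_ifs <;> simp

theorem eq_C_of_shiftBy_eq_self [IsDomain R] [CharZero R] [Finite σ] {p : MvPolynomial σ R}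
    (h : ∀ r, shiftBy r p = p) : p = C (constantCoeff p) :=
  eq_C_of_translate_eq_self span_range_intVec (Set.forall_mem_range.mpr h)

end Shift

section SymbolRelations

open MvPolynomial

variable {σ R : Type*} [CommRing R]

/-- The relations satisfied by the images `p s` of `1` under `h(s)` and `g r i` of `1` under
`t^r dᵢ` in a module on which `𝔥` and the `dᵢ` act by multiplication, `h(s)` acts as
`p s · shiftBy s` and `t^r dᵢ` as `g r i · shiftBy r`. The polynomial `κ` stands for the action of
the central element `[t^(-r) dᵢ, t^r dᵢ] - 2 rᵢ dᵢ`, which commutes with `t^r dᵢ`. -/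
structure SymbolRelations (h : R) (p : (σ → ℤ) → MvPolynomial σ R)
    (g : (σ → ℤ) → σ → MvPolynomial σ R) : Prop where
  apply_zero : p 0 = C h
  witt_loop : ∀ r s i, shiftBy r (p s) * g r i - shiftBy s (g r i) * p s
    = (s i : MvPolynomial σ R) * p (r + s)
  witt_witt : ∀ r i, r i ≠ 0 → ∃ κ : MvPolynomial σ R, shiftBy r κ * g r i = κ * g r i ∧
    shiftBy r (g (-r) i) * g r i - shiftBy (-r) (g r i) * g (-r) i
      = -(2 * (r i : MvPolynomial σ R) * X i) + κ

namespace SymbolRelations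

variable {h : R} {p : (σ → ℤ) → MvPolynomial σ R} {g : (σ → ℤ) → σ → MvPolynomial σ R}

section Degree

variable [IsDomain R] [CharZero R]

theorem natDegree_add (S : SymbolRelations h p g) (hh : h ≠ 0) {v : σ → ℤ} {m : ℤ} {i : σ}
    (hm : m ≠ 0) (hv : v i ≠ 0) :
    (along (intVec R v) (p (-(m • v)))).natDegree
        + (along (intVec R v) (g (m • v) i)).natDegree = 1 ∧
      (along (intVec R v) (p (-(m • v)))).leadingCoeff
        * (along (intVec R v) (g (m • v) i)).leadingCoeff = C (v i * h) := by
  have hm' : (m : MvPolynomial σ R) ≠ 0 := Int.cast_ne_zero.mpr hm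
  have hc : (m : MvPolynomial σ R) * C (v i * h) ≠ 0 :=
    mul_ne_zero hm' (by simpa using ⟨hv, hh⟩)
  have hrel := congrArg (along (intVec R v)) (S.witt_loop (m • v) (-(m • v)) i)
  rw [add_neg_cancel, S.apply_zero, Pi.neg_apply, Pi.smul_apply, ← neg_smul, map_sub, map_mul,
    map_mul, along_shiftBy_zsmul, along_shiftBy_zsmul, neg_smul] at hrel
  simp only [smul_eq_mul, map_neg, map_mul, map_intCast, along_C, Int.cast_neg, Int.cast_mul,
    neg_neg] at hrel
  obtain ⟨hdeg, hlead⟩ := natDegree_add_eq_of_mul_taylor_sub hm' (Polynomial.C_ne_zero.mpr hc)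
    (P := along (intVec R v) (p (-(m • v)))) (G := along (intVec R v) (g (m • v) i)) (by
      simp only [map_mul, map_intCast]
      linear_combination -hrel)
  rw [Polynomial.natDegree_C, zero_add] at hdeg
  rw [Polynomial.natDegree_C, Polynomial.leadingCoeff_C, Nat.cast_zero, zero_add, one_mul] at hlead
  exact ⟨hdeg, (mul_left_cancel₀ hm' hlead).symm⟩

theorem natDegree_add_natDegree_neg (S : SymbolRelations h p g) {r : σ → ℤ} {i : σ}
    (hr : r i ≠ 0) (hg : g r i ≠ 0) :
    (along (intVec R r) (g (-r) i)).natDegree + (along (intVec R r) (g r i)).natDegree = 2 ∧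
      (along (intVec R r) (g (-r) i)).leadingCoeff * (along (intVec R r) (g r i)).leadingCoeff
        = C ((r i : R) ^ 2) := by
  obtain ⟨κ, hκ, hrel⟩ := S.witt_witt r i hr
  have hκr : along (intVec R r) κ = Polynomial.C κ :=
    along_eq_C_of_translate_eq_self (mul_right_cancel₀ hg hκ)
  have hc : (2 * (r i : MvPolynomial σ R) ^ 2) ≠ 0 :=
    mul_ne_zero two_ne_zero (pow_ne_zero 2 (Int.cast_ne_zero.mpr hr))
  have hshift := along_shiftBy_zsmul (R := R) 1 r
  have hshift' := along_shiftBy_zsmul (R := R) (-1) r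
  simp only [neg_smul, one_smul, Int.cast_neg, Int.cast_one, neg_neg] at hshift hshift'
  have halong := congrArg (along (intVec R r)) hrel
  simp only [map_sub, map_add, map_mul, map_neg, hshift, hshift', hκr, along_X, intVec,
    map_intCast, map_ofNat] at halong
  have hlin := Polynomial.natDegree_linear (b := 2 * (r i : MvPolynomial σ R) * X i - κ) hc
  have hlead := Polynomial.leadingCoeff_linear (b := 2 * (r i : MvPolynomial σ R) * X i - κ) hc
  obtain ⟨hdeg, hlc⟩ := natDegree_add_eq_of_mul_taylor_sub (one_ne_zero (α := MvPolynomial σ R))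
    (Polynomial.ne_zero_of_natDegree_gt (hlin.symm ▸ one_pos))
    (P := along (intVec R r) (g (-r) i)) (G := along (intVec R r) (g r i)) (by
      simp only [map_sub, map_mul, map_pow, map_intCast, map_ofNat]
      linear_combination -halong)
  rw [hlin] at hdeg hlc
  rw [hlead] at hlc
  refine ⟨hdeg, mul_left_cancel₀ (two_ne_zero (α := MvPolynomial σ R)) ?_⟩
  rw [C_pow, map_intCast, hlc]
  push_cast
  ring

end Degree

theorem exists_unit_mul [IsDomain R] [Algebra ℚ R] (S : SymbolRelations h p g) (hh : h ≠ 0)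
    (r : σ → ℤ) : ∃ c : Rˣ, p r = C (c * h) := by
  have : CharZero R := algebraRat.charZero R
  rcases eq_or_ne r 0 with rfl | hr
  · exact ⟨1, by rw [S.apply_zero, Units.val_one, one_mul]⟩
  obtain ⟨i, hi⟩ := Function.ne_iff.mp hr
  obtain ⟨hdeg, hlead⟩ := S.natDegree_add hh one_ne_zero hi
  obtain ⟨hdeg', hlead'⟩ := S.natDegree_add hh (neg_ne_zero.mpr one_ne_zero) hi
  simp only [neg_smul, one_smul, neg_neg] at hdeg hdeg' hlead hlead'
  have hg : g r i ≠ 0 := by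
    intro h0
    rw [h0, map_zero, Polynomial.leadingCoeff_zero, mul_zero, eq_comm, C_eq_zero] at hlead
    exact mul_ne_zero (Int.cast_ne_zero.mpr hi) hh hlead
  obtain ⟨hgdeg, hglead⟩ := S.natDegree_add_natDegree_neg hi hg
  obtain ⟨q, hq⟩ : IsUnit (r i : R) := by
    simpa using (IsUnit.mk0 (r i : ℚ) (Int.cast_ne_zero.mpr hi)).map (algebraMap ℚ R)
  have hunit : IsUnit (along (intVec R r) (g (-r) i)).leadingCoeff :=
    isUnit_of_mul_isUnit_left (y := (along (intVec R r) (g r i)).leadingCoeff) <|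
      hglead ▸ hq ▸ (q ^ 2).isUnit.map C
  obtain ⟨_, ⟨u, rfl⟩, hu⟩ := isUnit_iff_eq_C_of_isReduced.mp hunit
  rw [along_eq_C_of_natDegree_eq_zero (by omega : (along (intVec R r) (p r)).natDegree = 0),
    Polynomial.leadingCoeff_C, hu] at hlead'
  refine ⟨q * u⁻¹, ?_⟩
  calc p r = p r * C (u : R) * C (↑u⁻¹ : R) := by
        rw [mul_assoc, ← C_mul, Units.mul_inv, C_1, mul_one]
    _ = C (↑(q * u⁻¹) * h) := by
        rw [hlead', ← hq, ← C_mul, Units.val_mul, mul_right_comm]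

end SymbolRelations

theorem eq_of_apply_mul_additive [IsDomain R] [CharZero R] {f : (σ → ℤ) → R} {i : σ}
    (hadd : ∀ s t, ((s + t) i : ℤ) * f (s + t) = s i * f s + t i * f t) {s t : σ → ℤ}
    (hs : s i ≠ 0) (ht : t i ≠ 0) : f s = f t := by
  let φ : (σ → ℤ) →+ R := AddMonoidHom.mk' (fun s => s i * f s) hadd
  have hφ : ∀ s, φ s = s i * f s := fun s => rfl
  have hzero : φ (t i • s - s i • t) = 0 := by
    have hi : (t i • s - s i • t) i = 0 := by
      simp only [Pi.sub_apply, Pi.smul_apply, smul_eq_mul]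
      ring
    rw [hφ, hi, Int.cast_zero, zero_mul]
  rw [map_sub, map_zsmul, map_zsmul, hφ, hφ, zsmul_eq_mul, zsmul_eq_mul] at hzero
  apply mul_left_cancel₀
    (mul_ne_zero (Int.cast_ne_zero (α := R).mpr hs) (Int.cast_ne_zero.mpr ht))
  linear_combination hzero

theorem map_add_eq_mul_of_div_eq {G : Type*} [CommGroup G] {ch : (σ → ℤ) → G} (h1 : ch 0 = 1)
    (hdiv : ∀ r s t i, s i ≠ 0 → t i ≠ 0 → ch (r + s) / ch s = ch (r + t) / ch t)
    (r s : σ → ℤ) : ch (r + s) = ch r * ch s := by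
  have hinv : ∀ r i, r i ≠ 0 → ch (-r) = (ch r)⁻¹ := by
    intro r i hr
    have hneg : (-r) i ≠ 0 := neg_ne_zero.mpr hr
    have htwo : (-r + -r) i ≠ 0 := by
      rw [Pi.add_apply]
      omega
    have hr2 := hdiv r (-r) (-r + -r) i hneg htwo
    have hr2' := hdiv (-r) r (-r) i hr hneg
    rw [add_neg_cancel, h1, add_neg_cancel_left] at hr2
    rw [neg_add_cancel, h1] at hr2'
    rw [eq_inv_iff_mul_eq_one, ← inv_inj, mul_inv, inv_one, ← one_div, ← one_div, hr2, hr2',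
      div_mul_div_cancel, div_self']
  have hadd : ∀ r s i, r i ≠ 0 → s i ≠ 0 → ch (r + s) = ch r * ch s := by
    intro r s i hr hs
    have hrs := hdiv r s (-r) i hs (neg_ne_zero.mpr hr)
    rwa [add_neg_cancel, h1, hinv r i hr, one_div, inv_inv, div_eq_iff_eq_mul] at hrs
  rcases eq_or_ne r 0 with rfl | hr
  · rw [zero_add, h1, one_mul]
  obtain ⟨i, hi⟩ := Function.ne_iff.mp hr
  by_cases hs : s i = 0
  · have hrs := hadd (r + s) (-r) i (by rwa [Pi.add_apply, hs, add_zero]) (neg_ne_zero.mpr hi)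
    rw [add_neg_cancel_comm, hinv r i hi] at hrs
    rw [hrs, mul_comm, inv_mul_cancel_right]
  · exact hadd r s i hi hs

namespace SymbolRelations

variable {h : R} {p : (σ → ℤ) → MvPolynomial σ R} {g : (σ → ℤ) → σ → MvPolynomial σ R}
  [IsDomain R]

theorem sub_shiftBy_eq (S : SymbolRelations h p g) (hh : h ≠ 0) {ch : (σ → ℤ) → Rˣ}
    (hp : ∀ r, p r = C (ch r * h)) (r s : σ → ℤ) (i : σ) :
    g r i - shiftBy s (g r i) = C ((s i : R) * ↑(ch (r + s) / ch s)) := by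
  have hrel := S.witt_loop r s i
  have hdiv : (ch s : R) * ↑(ch (r + s) / ch s) = ch (r + s) := by
    rw [← Units.val_mul, mul_div_cancel]
  rw [hp s, hp (r + s), shiftBy_C, ← hdiv] at hrel
  apply mul_left_cancel₀ (C_ne_zero.mpr (mul_ne_zero (ch s).ne_zero hh))
  simp only [C_mul, map_intCast] at hrel ⊢
  linear_combination hrel

theorem map_add_eq_mul [CharZero R] (S : SymbolRelations h p g) (hh : h ≠ 0) {ch : (σ → ℤ) → Rˣ}
    (hp : ∀ r, p r = C (ch r * h)) (r s : σ → ℤ) : ch (r + s) = ch r * ch s := by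
  refine map_add_eq_mul_of_div_eq ?_ (fun r s t i hs ht => Units.ext ?_) r s
  · have h0 := hp 0
    rw [S.apply_zero, C_inj] at h0
    exact Units.ext (mul_right_cancel₀ hh (by rw [← h0, Units.val_one, one_mul]))
  · refine eq_of_apply_mul_additive (f := fun s => ((ch (r + s) / ch s : Rˣ) : R))
      (fun s t => ?_) hs ht
    apply C_injective σ R
    have hst := congrArg (shiftBy s) (S.sub_shiftBy_eq hh hp r t i)
    rw [map_sub, shiftBy_shiftBy, shiftBy_C] at hst
    rw [C_add, ← S.sub_shiftBy_eq hh hp, ← S.sub_shiftBy_eq hh hp, ← hst]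
    ring

theorem exists_character_and_constants [Algebra ℚ R] [Finite σ] (S : SymbolRelations h p g)
    (hh : h ≠ 0) :
    ∃ ch : (σ → ℤ) → Rˣ, (∀ r s, ch (r + s) = ch r * ch s) ∧ (∀ r, p r = C (ch r * h)) ∧
      ∃ β : (σ → ℤ) → σ → R, ∀ r i, g r i = C (ch r : R) * (X i - C (β r i)) := by
  have : CharZero R := algebraRat.charZero R
  choose ch hp using S.exists_unit_mul hh
  have hmul := S.map_add_eq_mul hh hp
  refine ⟨ch, hmul, hp, fun r i => constantCoeff (X i - C (↑(ch r)⁻¹ : R) * g r i),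
    fun r i => ?_⟩
  have hinv : C (ch r : R) * C (↑(ch r)⁻¹ : R) = (1 : MvPolynomial σ R) := by
    rw [← C_mul, Units.mul_inv, C_1]
  rw [← eq_C_of_shiftBy_eq_self (p := X i - C (↑(ch r)⁻¹ : R) * g r i) fun s => ?_]
  · linear_combination -(g r i) * hinv
  · have hdiff := S.sub_shiftBy_eq hh hp r s i
    rw [hmul, mul_div_cancel_right, C_mul, map_intCast] at hdiff
    rw [map_sub, map_mul, shiftBy_C, shiftBy_X]
    linear_combination (C (↑(ch r)⁻¹ : R)) * hdiff + s i * hinv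

end SymbolRelations

end SymbolRelations

section WittConstants

variable {σ R : Type*} [CommRing R] [IsDomain R] [CharZero R]

theorem eq_zero_of_mul_sub_mul {f : ℤ → R} (h0 : f 0 = 0) (h1 : f 1 = 0)
    (hf : ∀ m l : ℤ, m * f m - l * f l = (m - l) * f (m + l)) {m : ℤ} (hm : m ≠ 0) :
    f m = 0 := by
  have hodd : ∀ m : ℤ, f (-m) = -f m := by
    intro m
    rcases eq_or_ne m 0 with rfl | hm
    · rw [neg_zero, h0, neg_zero]
    · have hneg := hf m (-m)
      rw [add_neg_cancel, h0, Int.cast_neg] at hneg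
      apply mul_left_cancel₀ (Int.cast_ne_zero (α := R).mpr hm)
      linear_combination hneg
  -- By oddness, the relation for `m + (1 - m) = 1` makes `m * f m` independent of `m`.
  have hstep : ∀ m : ℤ, m * f m = (m - 1 : ℤ) * f (m - 1) := by
    intro m
    have hsub := hf m (1 - m)
    rw [add_sub_cancel, h1, ← neg_sub m 1, hodd, Int.cast_neg] at hsub
    linear_combination hsub
  have hzero : ∀ m : ℤ, m * f m = 0 := by
    intro m
    induction m with
    | zero => rw [h0, mul_zero]
    | succ k ih => rw [hstep, add_sub_cancel_right, ih]
    | pred k ih => rw [← hstep, ih]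
  exact (mul_eq_zero.mp (hzero m)).resolve_left (Int.cast_ne_zero.mpr hm)

theorem eq_intCast_mul_of_mul_sub_mul {f : ℤ → R} (h0 : f 0 = 0)
    (hf : ∀ m l : ℤ, m * f m - l * f l = (m - l) * f (m + l)) (m : ℤ) : f m = m * f 1 := by
  rcases eq_or_ne m 0 with rfl | hm
  · rw [h0, Int.cast_zero, zero_mul]
  · refine sub_eq_zero.mp (eq_zero_of_mul_sub_mul (f := fun m => f m - m * f 1) ?_ ?_ ?_ hm)
    · rw [h0, Int.cast_zero, zero_mul, sub_zero]
    · rw [Int.cast_one, one_mul, sub_self]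
    · intro m l
      push_cast
      linear_combination hf m l

/-- The relations that the brackets of the Witt algebra impose on the constants `β r i` of an
action of the form `t^r dᵢ ↦ ch r · shiftBy r · (dᵢ - β r i)`, for a character `ch`. -/
structure WittConstants (β : (σ → ℤ) → σ → R) : Prop where
  apply_zero : ∀ i, β 0 i = 0
  mul_sub : ∀ r s i j, (r j : R) * (β r i - β (r + s) i) = s i * (β s j - β (r + s) j)

namespace WittConstants

variable {β : (σ → ℤ) → σ → R}

theorem apply_of_ne_zero [DecidableEq σ] (W : WittConstants β) {s : σ → ℤ} {i : σ}
    (hs : s i ≠ 0) : β s i = s i * β (Pi.single i 1) i := by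
  have hsingle := eq_intCast_mul_of_mul_sub_mul (f := fun m => β (Pi.single i m) i)
    (by rw [Pi.single_zero, W.apply_zero]) (fun m l => by
      have hml := W.mul_sub (Pi.single i m) (Pi.single i l) i i
      rw [Pi.single_eq_same, Pi.single_eq_same, ← Pi.single_add] at hml
      linear_combination hml)
  have hrest := W.mul_sub (s - Pi.single i (s i)) (Pi.single i (s i)) i i
  rw [sub_add_cancel, Pi.sub_apply, Pi.single_eq_same, sub_self, Int.cast_zero, zero_mul,
    hsingle] at hrest
  exact (sub_eq_zero.mp
    ((mul_eq_zero.mp hrest.symm).resolve_left (Int.cast_ne_zero.mpr hs))).symm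

theorem apply_eq_zero_and_eq [DecidableEq σ] (W : WittConstants β) {r : σ → ℤ} {i j : σ}
    (hri : r i = 0) (hrj : r j ≠ 0) :
    β r i = 0 ∧ β (Pi.single i 1) i = β (Pi.single j 1) j := by
  have hij : i ≠ j := by
    rintro rfl
    exact hrj hri
  have hr : ∀ m : ℤ, m ≠ 0 → β r i = m * (β (Pi.single i 1) i - β (Pi.single j 1) j) := by
    intro m hm
    obtain ⟨s, hsi, hsj⟩ : ∃ s : σ → ℤ, s i = m ∧ s j = r j :=
      ⟨Pi.single i m + Pi.single j (r j), by simp [hij], by simp [hij.symm]⟩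
    have hrs := W.mul_sub r s i j
    rw [W.apply_of_ne_zero (s := r + s) (i := i) (by simpa [hri, hsi] using hm),
      W.apply_of_ne_zero (s := r + s) (i := j) (by simpa [hsj] using hrj),
      W.apply_of_ne_zero (s := s) (i := j) (by rwa [hsj]), Pi.add_apply, Pi.add_apply, hri, hsi,
      hsj, zero_add] at hrs
    apply mul_left_cancel₀ (Int.cast_ne_zero (α := R).mpr hrj)
    push_cast at hrs
    linear_combination hrs
  have hone := hr 1 one_ne_zero
  have htwo := hr 2 two_ne_zero
  push_cast at hone htwo
  exact ⟨by linear_combination 2 * hone - htwo, by linear_combination hone - htwo⟩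

theorem exists_eq_mul (W : WittConstants β) : ∃ b : R, ∀ r i, β r i = r i * b := by
  classical
  rcases isEmpty_or_nonempty σ with hσ | ⟨⟨k⟩⟩
  · exact ⟨0, fun _ i => hσ.elim i⟩
  have hk : ∀ i, β (Pi.single i 1) i = β (Pi.single k 1) k := by
    intro i
    rcases eq_or_ne i k with rfl | hik
    · rfl
    · exact (W.apply_eq_zero_and_eq (Pi.single_eq_of_ne hik 1)
        (by rw [Pi.single_eq_same]; exact one_ne_zero)).2
  refine ⟨β (Pi.single k 1) k, fun r i => ?_⟩
  by_cases hri : r i = 0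
  · rw [hri, Int.cast_zero, zero_mul]
    rcases eq_or_ne r 0 with rfl | hr
    · exact W.apply_zero i
    · obtain ⟨j, hj⟩ := Function.ne_iff.mp hr
      exact (W.apply_eq_zero_and_eq hri hj).1
  · rw [W.apply_of_ne_zero hri, hk]

end WittConstants

open MvPolynomial in
theorem eq_C_of_shiftBy_neg_mul_sub {q : MvPolynomial σ R} {c y : R} {s : σ → ℤ} {i : σ}
    (hs : s i ≠ 0)
    (hq : shiftBy (-s) q * (X i + C c) - (X i - (s i : MvPolynomial σ R) + C c) * q
      = (s i : MvPolynomial σ R) * C y) : q = C y := by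
  -- `(q - y)(dᵢ - sᵢ + c)` is invariant under the shift, so of degree zero along `s`.
  have hinv : shiftBy (-s) ((q - C y) * (X i - (s i : MvPolynomial σ R) + C c))
      = (q - C y) * (X i - (s i : MvPolynomial σ R) + C c) := by
    simp only [map_mul, map_sub, map_add, shiftBy_X, shiftBy_C, map_intCast, Pi.neg_apply,
      Int.cast_neg]
    linear_combination hq
  have hdeg := congrArg Polynomial.natDegree (along_eq_C_of_translate_eq_self hinv)
  have hfactor : along (intVec R (-s)) (X i - (s i : MvPolynomial σ R) + C c)
      = Polynomial.C (-(s i : MvPolynomial σ R)) * Polynomial.X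
        + Polynomial.C (X i - (s i : MvPolynomial σ R) + C c) := by
    simp only [map_sub, map_add, along_X, along_C, map_intCast, intVec, Pi.neg_apply,
      Int.cast_neg, map_neg]
    ring
  have hlin := Polynomial.natDegree_linear (b := X i - (s i : MvPolynomial σ R) + C c)
    (neg_ne_zero.mpr (Int.cast_ne_zero.mpr hs))
  by_contra hne
  have hne' : along (intVec R (-s)) (q - C y) ≠ 0 :=
    (map_ne_zero_iff _ (along_injective _)).mpr (sub_ne_zero.mpr hne)
  rw [map_mul, hfactor, Polynomial.natDegree_mul hne'
    (Polynomial.ne_zero_of_natDegree_gt (hlin.symm ▸ one_pos)), hlin,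
    Polynomial.natDegree_C] at hdeg
  omega

end WittConstants

end FullToroidal

namespace FullToroidalAlgebra

open FullToroidal

variable {c₁ c₂ : ℂ} {n : ℕ} {𝔤 : Type*} [LieRing 𝔤] [LieAlgebra ℂ 𝔤]

variable (c₁ c₂) in
/-- The inclusion of `𝔤 ⊗ A` into `ℒ`. -/
def ofLoop : Laurent n ⊗[ℂ] 𝔤 →ₗ[ℂ] FullToroidalAlgebra c₁ c₂ n 𝔤 where
  toFun X := ⟨X, 0, 0⟩
  map_add' X Y := by ext1 <;> simp
  map_smul' c X := by ext1 <;> simp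

variable (c₁ c₂ 𝔤) in
/-- The inclusion of `𝒦_A` into `ℒ`. -/
def cenElt : KA n →ₗ[ℂ] FullToroidalAlgebra c₁ c₂ n 𝔤 where
  toFun k := ⟨0, k, 0⟩
  map_add' k l := by ext1 <;> simp
  map_smul' c k := by ext1 <;> simp

variable (c₁ c₂ 𝔤) in
/-- The inclusion of `Der(A)` into `ℒ`; it is linear, but not a Lie algebra homomorphism. -/
def ofDer : Witt n →ₗ[ℂ] FullToroidalAlgebra c₁ c₂ n 𝔤 where
  toFun D := ⟨0, 0, D⟩
  map_add' D E := by ext1 <;> simp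
  map_smul' c D := by ext1 <;> simp

variable (c₁ c₂) in
/-- The element `x(r) = x ⊗ t^r` of `ℒ`, linear in `x`. -/
def loopElt (r : Fin n → ℤ) : 𝔤 →ₗ[ℂ] FullToroidalAlgebra c₁ c₂ n 𝔤 :=
  ofLoop c₁ c₂ ∘ₗ TensorProduct.mk ℂ (Laurent n) 𝔤 (mono r)

variable (c₁ c₂ 𝔤) in
/-- The element `t^r dᵢ` of `ℒ`. -/
def wittElt (r : Fin n → ℤ) (i : Fin n) : FullToroidalAlgebra c₁ c₂ n 𝔤 :=
  ofDer c₁ c₂ 𝔤 (mono r • euler i)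

theorem ofLoop_add_cenElt_add_ofDer (X : FullToroidalAlgebra c₁ c₂ n 𝔤) :
    ofLoop c₁ c₂ X.loop + cenElt c₁ c₂ 𝔤 X.cen + ofDer c₁ c₂ 𝔤 X.der = X := by
  ext1 <;> simp [ofLoop, cenElt, ofDer]

theorem sum_coef_smul_euler (D : Witt n) : ∑ i, coef i D • euler i = D := by
  ext1 f
  rw [witt_apply D, witt_apply (∑ i, coef i D • euler i)]
  simp [map_sum, coef_smul_euler]

theorem linearMap_ext {M : Type*} [AddCommGroup M] [Module ℂ M]
    {S T : FullToroidalAlgebra c₁ c₂ n 𝔤 →ₗ[ℂ] M}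
    (hloop : ∀ r x, S (loopElt c₁ c₂ r x) = T (loopElt c₁ c₂ r x))
    (hcen : ∀ k, S (cenElt c₁ c₂ 𝔤 k) = T (cenElt c₁ c₂ 𝔤 k))
    (hwitt : ∀ r i, S (wittElt c₁ c₂ 𝔤 r i) = T (wittElt c₁ c₂ 𝔤 r i)) : S = T := by
  have hofLoop : S ∘ₗ ofLoop c₁ c₂ = T ∘ₗ ofLoop c₁ c₂ :=
    TensorProduct.ext <| (monoBasis n).ext fun r => LinearMap.ext fun x => by
      rw [monoBasis_apply]
      exact hloop r x
  have hofDer : ∀ i, S ∘ₗ ofDer c₁ c₂ 𝔤 ∘ₗ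
      (LinearMap.toSpanSingleton (Laurent n) (Witt n) (euler i)).restrictScalars ℂ
      = T ∘ₗ ofDer c₁ c₂ 𝔤 ∘ₗ
      (LinearMap.toSpanSingleton (Laurent n) (Witt n) (euler i)).restrictScalars ℂ :=
    fun i => (monoBasis n).ext fun r => by
      rw [monoBasis_apply]
      exact hwitt r i
  ext X
  rw [← ofLoop_add_cenElt_add_ofDer X, ← sum_coef_smul_euler X.der]
  simp only [map_add, map_sum, hcen]
  refine congrArg₂ (· + ·) (congrArg (· + _) ?_) ?_
  · exact DFunLike.congr_fun hofLoop X.loop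
  · exact Finset.sum_congr rfl fun i _ => DFunLike.congr_fun (hofDer i) (coef i X.der)

theorem jac_mono_smul (r : Fin n → ℤ) (i k l : Fin n) :
    jac (mono r • euler i : Witt n) k l = if i = k then (r l : ℂ) • mono r else 0 := by
  rw [jac, Matrix.of_apply, coef_smul_euler]
  split_ifs
  · rw [euler_mono]
  · rw [map_zero]

theorem trace_jac_mono_smul (r : Fin n → ℤ) (i : Fin n) :
    (jac (mono r • euler i : Witt n)).trace = (r i : ℂ) • mono r := by
  simp [Matrix.trace, jac_mono_smul]

theorem trPair_jac_mono_smul (r s : Fin n → ℤ) (i j : Fin n) :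
    trPair (jac (mono r • euler i : Witt n)) (jac (mono s • euler j))
      = ((s i : ℂ) * r j) • dClass (mono r) (mono s) := by
  simp only [trPair, jac_mono_smul]
  rw [Finset.sum_eq_single_of_mem i (Finset.mem_univ i) fun k _ hk => by simp [hk.symm],
    Finset.sum_eq_single_of_mem j (Finset.mem_univ j) fun l _ hl => by simp [hl.symm]]
  simp [smul_smul]

theorem phi_mono_smul (r s : Fin n → ℤ) (i j : Fin n) :
    phi c₁ c₂ (mono r • euler i) (mono s • euler j)
      = (c₂ * (r i * s j) - c₁ * (s i * r j)) • dClass (mono r) (mono s) := by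
  rw [phi, phi₁_eq, phi₂_eq, trace_jac_mono_smul, trace_jac_mono_smul, trPair_jac_mono_smul]
  simp only [map_smul, LinearMap.smul_apply]
  module

theorem lieKA_zero (k : KA n) : lieKA 0 k = 0 := by
  simpa only [zero_smul] using lieKA_smul 0 (0 : Witt n) k

theorem phi_zero_left (D : Witt n) : phi c₁ c₂ 0 D = 0 := by
  simpa only [zero_smul] using phi_smul_left c₁ c₂ 0 (0 : Witt n) D

theorem phi_zero_right (D : Witt n) : phi c₁ c₂ D 0 = 0 := by
  rw [phi_swap, phi_zero_left, neg_zero]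

theorem derLoop_zero (X : Laurent n ⊗[ℂ] 𝔤) : derLoop 0 X = 0 := by
  simpa only [zero_smul] using derLoop_smul 0 (0 : Witt n) X

theorem mono_smul_euler_lie (r s : Fin n → ℤ) (i j : Fin n) :
    ⁅(mono r • euler i : Witt n), (mono s • euler j : Witt n)⁆
      = (s i : ℂ) • (mono (r + s) • euler j) - (r j : ℂ) • (mono (r + s) • euler i) := by
  ext1 f
  simp only [Derivation.commutator_apply, Derivation.smul_apply, Derivation.sub_apply,
    Derivation.leibniz, smul_eq_mul, euler_mono, mono_add, euler_comm j i, Algebra.smul_def]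
  ring

theorem wittElt_lie_loopElt (r s : Fin n → ℤ) (i : Fin n) (x : 𝔤) :
    ⁅wittElt c₁ c₂ 𝔤 r i, loopElt c₁ c₂ s x⁆ = (s i : ℂ) • loopElt c₁ c₂ (r + s) x := by
  ext1
  · simp [wittElt, loopElt, ofLoop, ofDer, loop_lie, derLoop_tmul, derLoop_zero, euler_mono,
      mono_add, TensorProduct.smul_tmul']
  · simp [wittElt, loopElt, ofLoop, ofDer, cen_lie, phi_zero_right, lieKA_zero]
  · simp [wittElt, loopElt, ofLoop, ofDer, der_lie]

theorem wittElt_lie_loopElt_zero_lie {M : Type*} [AddCommGroup M]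
    [LieRingModule (FullToroidalAlgebra c₁ c₂ n 𝔤) M] (r : Fin n → ℤ) (i : Fin n) (x : 𝔤) (m : M) :
    ⁅wittElt c₁ c₂ 𝔤 r i, ⁅loopElt c₁ c₂ (0 : Fin n → ℤ) x, m⁆⁆
      = ⁅loopElt c₁ c₂ (0 : Fin n → ℤ) x, ⁅wittElt c₁ c₂ 𝔤 r i, m⁆⁆ := by
  have hcomm := lie_lie (wittElt c₁ c₂ 𝔤 r i) (loopElt c₁ c₂ (0 : Fin n → ℤ) x) m
  rw [wittElt_lie_loopElt, Pi.zero_apply, Int.cast_zero, zero_smul, zero_lie] at hcomm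
  exact sub_eq_zero.mp hcomm.symm

theorem loopElt_lie_loopElt (r s : Fin n → ℤ) (x y : 𝔤) :
    ⁅loopElt c₁ c₂ r x, loopElt c₁ c₂ s y⁆ = loopElt c₁ c₂ (r + s) ⁅x, y⁆
      + cenElt c₁ c₂ 𝔤 (killingForm ℂ 𝔤 x y • dClass (mono r) (mono s)) := by
  ext1
  · simp [loopElt, ofLoop, cenElt, loop_lie, mono_add, derLoop_zero]
  · simp [loopElt, ofLoop, cenElt, cen_lie, loopCocycle_tmul, phi_zero_right, lieKA_zero]
  · simp [loopElt, ofLoop, cenElt, der_lie]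

theorem loopElt_zero_lie_loopElt_zero (x y : 𝔤) :
    ⁅loopElt c₁ c₂ (0 : Fin n → ℤ) x, loopElt c₁ c₂ (0 : Fin n → ℤ) y⁆
      = loopElt c₁ c₂ (0 : Fin n → ℤ) ⁅x, y⁆ := by
  rw [loopElt_lie_loopElt, mono_zero, dClass_swap, dClass_one, neg_zero, smul_zero, map_zero,
    add_zero, add_zero]

theorem wittElt_lie_wittElt (r s : Fin n → ℤ) (i j : Fin n) :
    ⁅wittElt c₁ c₂ 𝔤 r i, wittElt c₁ c₂ 𝔤 s j⁆ = (s i : ℂ) • wittElt c₁ c₂ 𝔤 (r + s) j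
      - (r j : ℂ) • wittElt c₁ c₂ 𝔤 (r + s) i
      + cenElt c₁ c₂ 𝔤 (phi c₁ c₂ (mono r • euler i) (mono s • euler j)) := by
  rw [wittElt, wittElt, wittElt, wittElt, ← map_smul, ← map_smul, ← map_sub,
    ← mono_smul_euler_lie]
  ext1 <;> simp [ofDer, cenElt, loop_lie, cen_lie, der_lie]

theorem wittElt_lie_cenElt (r : Fin n → ℤ) (i : Fin n) (k : KA n) :
    ⁅wittElt c₁ c₂ 𝔤 r i, cenElt c₁ c₂ 𝔤 k⁆ = cenElt c₁ c₂ 𝔤 (lieKA (mono r • euler i) k) := by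
  ext1
  · simp [wittElt, ofDer, cenElt, loop_lie]
  · simp [wittElt, ofDer, cenElt, cen_lie, phi_zero_right, lieKA_zero]
  · simp [wittElt, ofDer, cenElt, der_lie]

theorem loopElt_lie_cenElt (r : Fin n → ℤ) (x : 𝔤) (k : KA n) :
    ⁅loopElt c₁ c₂ r x, cenElt c₁ c₂ 𝔤 k⁆ = 0 := by
  ext1
  · simp [loopElt, ofLoop, cenElt, loop_lie, derLoop_zero]
  · simp [loopElt, ofLoop, cenElt, cen_lie, phi_zero_right, lieKA_zero]
  · simp [loopElt, ofLoop, cenElt, der_lie]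

theorem lieKA_mono_smul_dClass_neg (r : Fin n → ℤ) (i : Fin n) :
    lieKA (mono r • euler i) (dClass (mono r) (mono (-r))) = 0 := by
  have hmul := dClass_mul (mono r) (mono r) (mono (-r))
  have hone := dClass_swap (mono r) 1
  rw [dClass_one, neg_zero] at hone
  rw [mono_neg_mul, mono_mul_neg, hone, add_zero] at hmul
  rw [lieKA_dClass]
  simp only [Derivation.smul_apply, euler_mono, smul_eq_mul, mul_smul_comm, mono_mul_neg,
    map_smul, LinearMap.smul_apply, hmul, hone, smul_zero, add_zero]

theorem lieKA_euler_dClass_neg (r : Fin n → ℤ) (i : Fin n) :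
    lieKA (euler i) (dClass (mono r) (mono (-r))) = 0 := by
  rw [lieKA_dClass, euler_mono, euler_mono, map_smul, LinearMap.smul_apply, map_smul,
    ← add_smul, Pi.neg_apply, Int.cast_neg, add_neg_cancel, zero_smul]

end FullToroidalAlgebra

namespace FullToroidal

open MvPolynomial

section Semilinear

variable {R A ι κ σ : Type*} [CommSemiring R]

theorem apply_mul_of_apply_X_mul [Semiring A] [Algebra R A] (ψ φ : MvPolynomial κ R →ₐ[R] A)
    (T : Module.End R A) (h : ∀ k f, T (ψ (X k) * f) = φ (X k) * T f) (q : MvPolynomial κ R)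
    (f : A) : T (ψ q * f) = φ q * T f := by
  induction q using MvPolynomial.induction_on generalizing f with
  | C c => rw [algHom_C, algHom_C, ← Algebra.smul_def, ← Algebra.smul_def, map_smul]
  | add p q hp hq => rw [map_add, add_mul, map_add, map_add, add_mul, hp, hq]
  | mul_X p k hp => rw [map_mul ψ, map_mul φ, mul_assoc, hp, h, mul_assoc]

theorem apply_mul_of_apply_variable_mul
    (φ : MvPolynomial σ (MvPolynomial ι R) →ₐ[R] MvPolynomial σ (MvPolynomial ι R))
    (T : Module.End R (MvPolynomial σ (MvPolynomial ι R)))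
    (hC : ∀ k f, T (C (X k) * f) = φ (C (X k)) * T f) (hX : ∀ i f, T (X i * f) = φ (X i) * T f)
    (f g : MvPolynomial σ (MvPolynomial ι R)) : T (f * g) = φ f * T g := by
  obtain ⟨q, rfl⟩ := (sumAlgEquiv R σ ι).surjective f
  refine apply_mul_of_apply_X_mul (sumAlgEquiv R σ ι).toAlgHom
    (φ.comp (sumAlgEquiv R σ ι).toAlgHom) T (fun k f => ?_) q g
  rcases k with i | k
  · simpa [sumAlgEquiv_X_inl] using hX i f
  · simpa [sumAlgEquiv_X_inr] using hC k f

end Semilinear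

theorem exists_eq_C_of_sub_sq_eq_C {ι K : Type*} [Field K] [IsAlgClosed K] [NeZero (2 : K)]
    {b : MvPolynomial ι K} {z : K} (h : b - b ^ 2 = C z) : ∃ w : K, b = C w := by
  obtain ⟨s, hs⟩ := IsAlgClosed.exists_pow_nat_eq (1 - 4 * z) two_pos
  have hfactor : (b - C ((1 + s) / 2)) * (b - C ((1 - s) / 2)) = 0 := by
    have hsum : (C ((1 + s) / 2) : MvPolynomial ι K) + C ((1 - s) / 2) = 1 := by
      rw [← C_add, ← C_1, ← add_div, add_add_sub_cancel, one_add_one_eq_two, div_self two_ne_zero]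
    have hprod : (C ((1 + s) / 2) : MvPolynomial ι K) * C ((1 - s) / 2) = C z := by
      rw [← C_mul]
      congr 1
      field_simp
      linear_combination -hs
    linear_combination -h - b * hsum + hprod
  rcases mul_eq_zero.mp hfactor with hb | hb
  · exact ⟨_, sub_eq_zero.mp hb⟩
  · exact ⟨_, sub_eq_zero.mp hb⟩

theorem eq_lamPow {n : ℕ} (ch : (Fin n → ℤ) → ℂˣ) (h : ∀ r s, ch (r + s) = ch r * ch s)
    (r : Fin n → ℤ) : (ch r : ℂ) = lamPow (fun j => ch (Pi.single j 1)) r := by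
  let φ : (Fin n → ℤ) →+ Additive ℂˣ := AddMonoidHom.mk' (Additive.ofMul ∘ ch) h
  have hr : r = ∑ j, r j • (Pi.single j 1 : Fin n → ℤ) := by
    simpa using pi_eq_sum_univ' r
  have hφ : φ r = ∑ j, r j • φ (Pi.single j 1) := by
    conv_lhs => rw [hr]
    rw [map_sum]
    simp only [map_zsmul]
  exact congrArg (fun u : Additive ℂˣ => (u.toMul : ℂ)) hφ

theorem lamPow_ne_zero {n : ℕ} (Λ : Fin n → ℂˣ) (r : Fin n → ℤ) : lamPow Λ r ≠ 0 :=
  Units.ne_zero _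

end FullToroidal

namespace FullToroidal

open MvPolynomial FullToroidalAlgebra

/-- The algebra `U(𝔥̃ₙ)` in coordinates: the outer variables are `d₁, …, dₙ`, the inner ones are
the elements of a basis of `𝔥`, indexed by `ι`. -/
abbrev CartanPolynomial (n : ℕ) (ι : Type*) : Type _ := MvPolynomial (Fin n) (MvPolynomial ι ℂ)

variable {c₁ c₂ : ℂ} {n : ℕ} {𝔤 : Type*} [LieRing 𝔤] [LieAlgebra ℂ 𝔤] {𝔥 : LieSubalgebra ℂ 𝔤}
  {ι : Type*}

/-- An `ℒ`-module structure on `U(𝔥̃ₙ)`, in the coordinates given by a basis of `𝔥`, for which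
`𝔥̃ₙ` acts by multiplication. -/
structure IsPolynomialModule (c₁ c₂ : ℂ) (n : ℕ) (hb : Module.Basis ι ℂ 𝔥)
    [LieRingModule (FullToroidalAlgebra c₁ c₂ n 𝔤) (CartanPolynomial n ι)] : Prop where
  euler_lie : ∀ i (f : CartanPolynomial n ι), ⁅wittElt c₁ c₂ 𝔤 0 i, f⁆ = X i * f
  cartan_lie : ∀ (h : 𝔥) (f : CartanPolynomial n ι),
    ⁅loopElt c₁ c₂ (0 : Fin n → ℤ) (h : 𝔤), f⁆ = C (linearPoly hb h) * f

theorem exists_lamPow_eq (ch : (Fin n → ℤ) → (MvPolynomial ι ℂ)ˣ)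
    (h : ∀ r s, ch (r + s) = ch r * ch s) :
    ∃ Λ : Fin n → ℂˣ, ∀ r, (ch r : MvPolynomial ι ℂ) = C (lamPow Λ r) := by
  let χ : (Fin n → ℤ) → ℂˣ :=
    fun r => Units.map (constantCoeff : MvPolynomial ι ℂ →+* ℂ).toMonoidHom (ch r)
  refine ⟨fun j => χ (Pi.single j 1), fun r => ?_⟩
  rw [← eq_lamPow χ (fun r s => by rw [← map_mul, ← h])]
  obtain ⟨z, -, hz⟩ := isUnit_iff_eq_C_of_isReduced.mp (ch r).isUnit
  simp [χ, hz]

namespace IsPolynomialModule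

variable {hb : Module.Basis ι ℂ 𝔥}
  [LieRingModule (FullToroidalAlgebra c₁ c₂ n 𝔤) (CartanPolynomial n ι)]
  [LieModule ℂ (FullToroidalAlgebra c₁ c₂ n 𝔤) (CartanPolynomial n ι)]

theorem wittElt_lie_mul (H : IsPolynomialModule c₁ c₂ n hb) (r : Fin n → ℤ) (i : Fin n)
    (f g : CartanPolynomial n ι) :
    ⁅wittElt c₁ c₂ 𝔤 r i, f * g⁆ = shiftBy r f * ⁅wittElt c₁ c₂ 𝔤 r i, g⁆ := by
  refine apply_mul_of_apply_variable_mul ((shiftBy r).restrictScalars ℂ)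
    (LieModule.toEnd ℂ _ _ (wittElt c₁ c₂ 𝔤 r i)) (fun k f => ?_) (fun j f => ?_) f g
  · have hcomm := lie_lie (wittElt c₁ c₂ 𝔤 r i) (loopElt c₁ c₂ 0 (hb k : 𝔤)) f
    rw [wittElt_lie_loopElt, Pi.zero_apply, Int.cast_zero, zero_smul, zero_lie, H.cartan_lie,
      H.cartan_lie, linearPoly_basis] at hcomm
    rw [AlgHom.restrictScalars_apply, shiftBy_C]
    exact sub_eq_zero.mp hcomm.symm
  · have hcomm := lie_lie (wittElt c₁ c₂ 𝔤 0 j) (wittElt c₁ c₂ 𝔤 r i) f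
    rw [wittElt_lie_wittElt, phi_mono_smul, H.euler_lie, H.euler_lie, mono_zero, dClass_one,
      smul_zero, map_zero, add_zero, Pi.zero_apply, Int.cast_zero, zero_smul, sub_zero, zero_add,
      smul_lie, Algebra.smul_def, map_intCast] at hcomm
    rw [AlgHom.restrictScalars_apply, shiftBy_X, LieModule.toEnd_apply_apply,
      LieModule.toEnd_apply_apply]
    linear_combination hcomm

theorem wittElt_lie_eq_mul (H : IsPolynomialModule c₁ c₂ n hb) (r : Fin n → ℤ) (i : Fin n)
    (f : CartanPolynomial n ι) :
    ⁅wittElt c₁ c₂ 𝔤 r i, f⁆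
      = shiftBy r f * ⁅wittElt c₁ c₂ 𝔤 r i, (1 : CartanPolynomial n ι)⁆ := by
  rw [← H.wittElt_lie_mul, mul_one]

theorem loopElt_lie_X_mul (H : IsPolynomialModule c₁ c₂ n hb) (r : Fin n → ℤ) (x : 𝔤) (j : Fin n)
    (f : CartanPolynomial n ι) :
    ⁅loopElt c₁ c₂ r x, X j * f⁆
      = (X j - (r j : CartanPolynomial n ι)) * ⁅loopElt c₁ c₂ r x, f⁆ := by
  have hcomm := lie_lie (wittElt c₁ c₂ 𝔤 0 j) (loopElt c₁ c₂ r x) f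
  rw [wittElt_lie_loopElt, H.euler_lie, H.euler_lie, zero_add, smul_lie, Algebra.smul_def,
    map_intCast] at hcomm
  linear_combination hcomm

theorem loopElt_lie_map_mul (H : IsPolynomialModule c₁ c₂ n hb) (r : Fin n → ℤ) (x : 𝔤)
    (q : MvPolynomial (Fin n) ℂ) (f : CartanPolynomial n ι) :
    ⁅loopElt c₁ c₂ r x, map C q * f⁆ = shiftBy r (map C q) * ⁅loopElt c₁ c₂ r x, f⁆ := by
  let ψ : MvPolynomial (Fin n) ℂ →ₐ[ℂ] CartanPolynomial n ι := mapAlgHom (Algebra.ofId ℂ _)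
  refine apply_mul_of_apply_X_mul ψ (((shiftBy r).restrictScalars ℂ).comp ψ)
    (LieModule.toEnd ℂ _ _ (loopElt c₁ c₂ r x)) (fun j f => ?_) q f
  simpa [ψ, shiftBy_X] using H.loopElt_lie_X_mul r x j f

theorem loopElt_cartan_lie_mul [IsLieAbelian 𝔥] (H : IsPolynomialModule c₁ c₂ n hb)
    (r : Fin n → ℤ) (h : 𝔥) (f g : CartanPolynomial n ι) :
    ⁅loopElt c₁ c₂ r (h : 𝔤), f * g⁆ = shiftBy r f * ⁅loopElt c₁ c₂ r (h : 𝔤), g⁆ := by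
  refine apply_mul_of_apply_variable_mul ((shiftBy r).restrictScalars ℂ)
    (LieModule.toEnd ℂ _ _ (loopElt c₁ c₂ r (h : 𝔤))) (fun k f => ?_) (fun j f => ?_) f g
  · have hcomm := lie_lie (loopElt c₁ c₂ r (h : 𝔤)) (loopElt c₁ c₂ 0 (hb k : 𝔤)) f
    rw [loopElt_lie_loopElt, ← LieSubalgebra.coe_bracket, trivial_lie_zero 𝔥 𝔥, mono_zero,
      dClass_swap, dClass_one, neg_zero, smul_zero, map_zero, add_zero, ZeroMemClass.coe_zero,
      map_zero, zero_lie, H.cartan_lie, H.cartan_lie, linearPoly_basis] at hcomm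
    rw [AlgHom.restrictScalars_apply, shiftBy_C]
    exact sub_eq_zero.mp hcomm.symm
  · rw [AlgHom.restrictScalars_apply, shiftBy_X]
    exact H.loopElt_lie_X_mul r h j f

theorem loopElt_cartan_lie_eq_mul [IsLieAbelian 𝔥] (H : IsPolynomialModule c₁ c₂ n hb)
    (r : Fin n → ℤ) (h : 𝔥) (f : CartanPolynomial n ι) :
    ⁅loopElt c₁ c₂ r (h : 𝔤), f⁆
      = shiftBy r f * ⁅loopElt c₁ c₂ r (h : 𝔤), (1 : CartanPolynomial n ι)⁆ := by
  rw [← H.loopElt_cartan_lie_mul, mul_one]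

theorem cenElt_dClass_neg_lie_mul (H : IsPolynomialModule c₁ c₂ n hb) (r : Fin n → ℤ)
    (f g : CartanPolynomial n ι) :
    ⁅cenElt c₁ c₂ 𝔤 (dClass (mono r) (mono (-r))), f * g⁆
      = f * ⁅cenElt c₁ c₂ 𝔤 (dClass (mono r) (mono (-r))), g⁆ := by
  refine apply_mul_of_apply_variable_mul (AlgHom.id ℂ _)
    (LieModule.toEnd ℂ _ _ (cenElt c₁ c₂ 𝔤 (dClass (mono r) (mono (-r)))))
    (fun k f => ?_) (fun j f => ?_) f g
  · have hcomm := lie_lie (loopElt c₁ c₂ 0 (hb k : 𝔤))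
      (cenElt c₁ c₂ 𝔤 (dClass (mono r) (mono (-r)))) f
    rw [loopElt_lie_cenElt, zero_lie, H.cartan_lie, H.cartan_lie, linearPoly_basis] at hcomm
    exact (sub_eq_zero.mp hcomm.symm).symm
  · have hcomm := lie_lie (wittElt c₁ c₂ 𝔤 0 j)
      (cenElt c₁ c₂ 𝔤 (dClass (mono r) (mono (-r)))) f
    rw [wittElt_lie_cenElt, mono_zero, one_smul, lieKA_euler_dClass_neg, map_zero, zero_lie,
      H.euler_lie, H.euler_lie] at hcomm
    exact (sub_eq_zero.mp hcomm.symm).symm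

theorem symbolRelations [IsLieAbelian 𝔥] (H : IsPolynomialModule c₁ c₂ n hb) (h : 𝔥) :
    SymbolRelations (linearPoly hb h)
      (fun r => ⁅loopElt c₁ c₂ r (h : 𝔤), (1 : CartanPolynomial n ι)⁆)
      (fun r i => ⁅wittElt c₁ c₂ 𝔤 r i, (1 : CartanPolynomial n ι)⁆) where
  apply_zero := by rw [H.cartan_lie, mul_one]
  witt_loop r s i := by
    have hcomm := lie_lie (wittElt c₁ c₂ 𝔤 r i) (loopElt c₁ c₂ s (h : 𝔤)) (1 : CartanPolynomial n ι)
    rw [wittElt_lie_loopElt, smul_lie, Algebra.smul_def, map_intCast] at hcomm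
    rw [hcomm, ← H.wittElt_lie_eq_mul, ← H.loopElt_cartan_lie_eq_mul]
  witt_witt r i _ := by
    let d := ⁅cenElt c₁ c₂ 𝔤 (dClass (mono r) (mono (-r))), (1 : CartanPolynomial n ι)⁆
    let g := ⁅wittElt c₁ c₂ 𝔤 r i, (1 : CartanPolynomial n ι)⁆
    have hd : shiftBy r d * g = d * g := by
      have hcomm := lie_lie (wittElt c₁ c₂ 𝔤 r i) (cenElt c₁ c₂ 𝔤 (dClass (mono r) (mono (-r))))
        (1 : CartanPolynomial n ι)
      rw [wittElt_lie_cenElt, lieKA_mono_smul_dClass_neg, map_zero, zero_lie] at hcomm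
      calc shiftBy r d * g = ⁅cenElt c₁ c₂ 𝔤 (dClass (mono r) (mono (-r))), g⁆ := by
            rw [← H.wittElt_lie_eq_mul]
            exact sub_eq_zero.mp hcomm.symm
        _ = d * g := by rw [← mul_one g, H.cenElt_dClass_neg_lie_mul, mul_one, mul_comm]
    refine ⟨C (C (c₂ * (r i * (-r) i) - c₁ * ((-r) i * r i))) * d, ?_, ?_⟩
    · rw [map_mul, shiftBy_C, mul_assoc, mul_assoc, hd]
    · have hcomm := lie_lie (wittElt c₁ c₂ 𝔤 r i) (wittElt c₁ c₂ 𝔤 (-r) i)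
        (1 : CartanPolynomial n ι)
      rw [wittElt_lie_wittElt, phi_mono_smul, add_neg_cancel, add_lie, sub_lie, smul_lie,
        smul_lie, H.euler_lie, map_smul, smul_lie] at hcomm
      rw [← H.wittElt_lie_eq_mul, ← H.wittElt_lie_eq_mul, ← hcomm]
      simp only [Algebra.smul_def, map_intCast, Pi.neg_apply, Int.cast_neg, mul_one, map_neg,
        MvPolynomial.algebraMap_apply, MvPolynomial.algebraMap_eq, d]
      ring

theorem exists_witt_form [IsLieAbelian 𝔥] (H : IsPolynomialModule c₁ c₂ n hb) {h : 𝔥}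
    (h0 : h ≠ 0) :
    ∃ (Λ : Fin n → ℂˣ) (β : (Fin n → ℤ) → Fin n → MvPolynomial ι ℂ),
      (∀ r : Fin n → ℤ, ⁅loopElt c₁ c₂ r (h : 𝔤), (1 : CartanPolynomial n ι)⁆
        = C (C (lamPow Λ r) * linearPoly hb h)) ∧
      ∀ r i, ⁅wittElt c₁ c₂ 𝔤 r i, (1 : CartanPolynomial n ι)⁆
        = C (C (lamPow Λ r)) * (X i - C (β r i)) := by
  obtain ⟨ch, hmul, hloop, β, hwitt⟩ := (H.symbolRelations h).exists_character_and_constants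
    ((map_ne_zero_iff _ (linearPoly_injective hb)).mpr h0)
  obtain ⟨Λ, hΛ⟩ := exists_lamPow_eq ch hmul
  simp only [hΛ] at hloop hwitt
  exact ⟨Λ, β, hloop, hwitt⟩

theorem cenElt_lie_eq_zero [IsLieAbelian 𝔥] (H : IsPolynomialModule c₁ c₂ n hb) {h : 𝔥}
    (hh : killingForm ℂ 𝔤 (h : 𝔤) (h : 𝔤) ≠ 0) {Λ : Fin n → ℂˣ}
    (hloop : ∀ r : Fin n → ℤ, ⁅loopElt c₁ c₂ r (h : 𝔤), (1 : CartanPolynomial n ι)⁆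
      = C (C (lamPow Λ r) * linearPoly hb h)) (k : KA n) (f : CartanPolynomial n ι) :
    ⁅cenElt c₁ c₂ 𝔤 k, f⁆ = 0 := by
  have hmono : ∀ r s : Fin n → ℤ, ⁅cenElt c₁ c₂ 𝔤 (dClass (mono r) (mono s)), f⁆ = 0 := by
    intro r s
    have hcomm := lie_lie (loopElt c₁ c₂ r (h : 𝔤)) (loopElt c₁ c₂ s (h : 𝔤)) f
    rw [loopElt_lie_loopElt, lie_self, map_zero, zero_add, map_smul, smul_lie] at hcomm
    refine (smul_eq_zero.mp (hcomm.trans ?_)).resolve_left hh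
    simp only [H.loopElt_cartan_lie_eq_mul _ _ f, H.loopElt_cartan_lie_eq_mul _ _ (_ * _), hloop,
      map_mul, shiftBy_C, shiftBy_shiftBy, add_comm s r]
    ring
  induction k using KA_induction with
  | h0 => rw [map_zero, zero_lie]
  | ha k l hk hl => rw [map_add, add_lie, hk, hl, add_zero]
  | hc u w =>
    induction u using laurent_induction with
    | ha u u' hu hu' => rw [map_add, LinearMap.add_apply, map_add, add_lie, hu, hu', add_zero]
    | hs c u hu => rw [map_smul, LinearMap.smul_apply, map_smul, smul_lie, hu, smul_zero]
    | hm r =>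
      induction w using laurent_induction with
      | ha w w' hw hw' => rw [map_add, map_add, add_lie, hw, hw', add_zero]
      | hs c w hw => rw [map_smul, map_smul, smul_lie, hw, smul_zero]
      | hm s => exact hmono r s

theorem wittConstants (H : IsPolynomialModule c₁ c₂ n hb) {Λ : Fin n → ℂˣ}
    {β : (Fin n → ℤ) → Fin n → MvPolynomial ι ℂ}
    (hwitt : ∀ r i, ⁅wittElt c₁ c₂ 𝔤 r i, (1 : CartanPolynomial n ι)⁆
      = C (C (lamPow Λ r)) * (X i - C (β r i)))
    (hcen : ∀ (k : KA n) (f : CartanPolynomial n ι), ⁅cenElt c₁ c₂ 𝔤 k, f⁆ = 0) :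
    WittConstants β where
  apply_zero i := by
    have hzero := hwitt 0 i
    rw [H.euler_lie, lamPow_zero, C_1, C_1, one_mul, mul_one, eq_comm, sub_eq_self,
      C_eq_zero] at hzero
    exact hzero
  mul_sub r s i j := by
    have hcomm := lie_lie (wittElt c₁ c₂ 𝔤 r i) (wittElt c₁ c₂ 𝔤 s j) (1 : CartanPolynomial n ι)
    rw [wittElt_lie_wittElt, add_lie, hcen, add_zero, sub_lie, smul_lie, smul_lie,
      H.wittElt_lie_eq_mul r i ⁅_, _⁆, H.wittElt_lie_eq_mul s j ⁅_, _⁆] at hcomm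
    simp only [hwitt, map_mul, map_sub, shiftBy_X, shiftBy_C, lamPow_add, Algebra.smul_def,
      map_intCast] at hcomm
    have hne : ∀ r, (C (C (lamPow Λ r)) : CartanPolynomial n ι) ≠ 0 := fun r =>
      C_ne_zero.mpr (C_ne_zero.mpr (lamPow_ne_zero Λ r))
    apply C_injective (Fin n) (MvPolynomial ι ℂ)
    apply mul_left_cancel₀ (mul_ne_zero (hne r) (hne s))
    simp only [map_mul, map_sub, map_intCast]
    linear_combination -hcomm

end IsPolynomialModule

end FullToroidal

namespace FullToroidal

open MvPolynomial FullToroidalAlgebra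

section CartanSubalgebra

variable {𝔤 : Type*} [LieRing 𝔤] [LieAlgebra ℂ 𝔤] [FiniteDimensional ℂ 𝔤]
  [LieAlgebra.IsKilling ℂ 𝔤] (𝔥 : LieSubalgebra ℂ 𝔤) [𝔥.IsCartanSubalgebra]

theorem exists_mem_cartan_killingForm_ne_zero [Nontrivial 𝔤] :
    ∃ h : 𝔥, killingForm ℂ 𝔤 (h : 𝔤) (h : 𝔤) ≠ 0 := by
  have hne : LieModule.traceForm ℂ 𝔥 𝔤 ≠ 0 :=
    (LieAlgebra.IsKilling.traceForm_cartan_nondegenerate ℂ 𝔤 𝔥).ne_zero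
  exact LinearMap.BilinForm.exists_bilinForm_self_ne_zero hne
    (LieModule.traceForm_isSymm ℂ 𝔥 𝔤)

variable {𝔥}

theorem span_range_weight_apply_basis {ι : Type*} (hb : Module.Basis ι ℂ 𝔥) :
    Submodule.span ℂ (Set.range fun (α : LieModule.Weight ℂ 𝔥 𝔤) (k : ι) => α (hb k)) = ⊤ := by
  let evalBasis : Module.Dual ℂ 𝔥 →ₗ[ℂ] (ι → ℂ) := LinearMap.pi fun k => LinearMap.applyₗ (hb k)
  have hsurj : Function.Surjective evalBasis := fun v =>
    ⟨hb.constr ℂ v, funext fun k => hb.constr_basis ℂ v k⟩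
  have hrange : (Set.range fun (α : LieModule.Weight ℂ 𝔥 𝔤) (k : ι) => α (hb k))
      = evalBasis '' Set.range (LieModule.Weight.toLinear ℂ 𝔥 𝔤) := by
    rw [← Set.range_comp]
    rfl
  rw [hrange, Submodule.span_image, LieAlgebra.IsKilling.span_weight_eq_top, Submodule.map_top,
    LinearMap.range_eq_top.mpr hsurj]

end CartanSubalgebra

namespace IsPolynomialModule

variable {c₁ c₂ : ℂ} {n : ℕ} {𝔤 : Type*} [LieRing 𝔤] [LieAlgebra ℂ 𝔤] {𝔥 : LieSubalgebra ℂ 𝔤}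
  {ι : Type*} {hb : Module.Basis ι ℂ 𝔥}
  [LieRingModule (FullToroidalAlgebra c₁ c₂ n 𝔤) (CartanPolynomial n ι)]
  [LieModule ℂ (FullToroidalAlgebra c₁ c₂ n 𝔤) (CartanPolynomial n ι)]

theorem loopElt_zero_lie_mul_of_mem_rootSpace [FiniteDimensional ℂ 𝔤] [LieAlgebra.IsKilling ℂ 𝔤]
    [𝔥.IsCartanSubalgebra] (H : IsPolynomialModule c₁ c₂ n hb) {α : 𝔥 → ℂ} {x : 𝔤}
    (hx : x ∈ LieAlgebra.rootSpace 𝔥 α) (f g : CartanPolynomial n ι) :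
    ⁅loopElt c₁ c₂ (0 : Fin n → ℤ) x, f * g⁆
      = map (translate fun k => α (hb k)).toRingHom f * ⁅loopElt c₁ c₂ (0 : Fin n → ℤ) x, g⁆ := by
  refine apply_mul_of_apply_variable_mul (mapAlgHom (translate fun k => α (hb k)))
    (LieModule.toEnd ℂ _ _ (loopElt c₁ c₂ (0 : Fin n → ℤ) x)) (fun k f => ?_) (fun j f => ?_) f g
  · have hcomm := lie_lie (loopElt c₁ c₂ (0 : Fin n → ℤ) (hb k : 𝔤))
      (loopElt c₁ c₂ (0 : Fin n → ℤ) x) f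
    have hroot : ⁅(hb k : 𝔤), x⁆ = α (hb k) • x :=
      LieAlgebra.IsKilling.lie_eq_smul_of_mem_rootSpace hx (hb k)
    rw [loopElt_zero_lie_loopElt_zero, hroot, map_smul, smul_lie, H.cartan_lie, H.cartan_lie,
      linearPoly_basis, Algebra.smul_def, MvPolynomial.algebraMap_apply,
      MvPolynomial.algebraMap_eq] at hcomm
    have hX : mapAlgHom (translate fun k => α (hb k)) (C (X k) : CartanPolynomial n ι)
        = C (X k) - C (C (α (hb k))) := by
      rw [← C_sub, ← translate_X fun k => α (hb k)]
      exact map_C _ _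
    rw [hX, LieModule.toEnd_apply_apply, LieModule.toEnd_apply_apply]
    linear_combination hcomm
  · simpa using H.loopElt_lie_X_mul 0 x j f

theorem exists_mem_rootSpace_loopElt_zero_lie_one_ne_zero [FiniteDimensional ℂ 𝔤]
    [LieAlgebra.IsKilling ℂ 𝔤] [𝔥.IsCartanSubalgebra] (H : IsPolynomialModule c₁ c₂ n hb)
    {α : LieModule.Weight ℂ 𝔥 𝔤} (hα : α.IsNonZero) :
    ∃ x ∈ LieAlgebra.rootSpace 𝔥 α,
      ⁅loopElt c₁ c₂ (0 : Fin n → ℤ) x, (1 : CartanPolynomial n ι)⁆ ≠ 0 := by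
  obtain ⟨h, e, f, ht, he, hf⟩ := LieAlgebra.IsKilling.exists_isSl2Triple_of_weight_isNonZero hα
  refine ⟨e, he, fun hzero => ?_⟩
  have hact : ∀ g : CartanPolynomial n ι, ⁅loopElt c₁ c₂ (0 : Fin n → ℤ) e, g⁆ = 0 := fun g => by
    rw [← mul_one g, H.loopElt_zero_lie_mul_of_mem_rootSpace he, hzero, mul_zero]
  have hcoroot := H.cartan_lie (LieAlgebra.IsKilling.coroot α) 1
  rw [← ht.h_eq_coroot hα he hf, ← ht.lie_e_f, ← loopElt_zero_lie_loopElt_zero, lie_lie, hact,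
    hact, lie_zero, sub_zero, mul_one, eq_comm, C_eq_zero,
    map_eq_zero_iff _ (linearPoly_injective hb)] at hcoroot
  exact ht.h_ne_zero (by rw [ht.h_eq_coroot hα he hf, hcoroot, ZeroMemClass.coe_zero])

theorem eq_C_of_loopElt_zero_lie_C_mul [FiniteDimensional ℂ 𝔤] [LieAlgebra.IsKilling ℂ 𝔤]
    [𝔥.IsCartanSubalgebra] (H : IsPolynomialModule c₁ c₂ n hb) {y : MvPolynomial ι ℂ}
    (hy : ∀ (x : 𝔤) (f : CartanPolynomial n ι), ⁅loopElt c₁ c₂ (0 : Fin n → ℤ) x, C y * f⁆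
      = C y * ⁅loopElt c₁ c₂ (0 : Fin n → ℤ) x, f⁆) : y = C (constantCoeff y) := by
  refine eq_C_of_translate_eq_self (span_range_weight_apply_basis hb) ?_
  rintro _ ⟨α, rfl⟩
  change translate (fun k => α (hb k)) y = y
  by_cases hα : α.IsZero
  · have hα0 : (fun k => α (hb k)) = 0 := funext fun k => congrFun hα (hb k)
    rw [hα0, translate_zero]
  · obtain ⟨x, hx, hne⟩ := H.exists_mem_rootSpace_loopElt_zero_lie_one_ne_zero hα
    have hmul := H.loopElt_zero_lie_mul_of_mem_rootSpace hx (C y) 1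
    rw [hy, map_C] at hmul
    exact (C_injective (Fin n) _ (mul_right_cancel₀ hne hmul)).symm

theorem C_sub_sq_mul (H : IsPolynomialModule c₁ c₂ n hb) {Λ : Fin n → ℂˣ} {b : MvPolynomial ι ℂ}
    {i : Fin n}
    (hwitt : ∀ r, ⁅wittElt c₁ c₂ 𝔤 r i, (1 : CartanPolynomial n ι)⁆
      = C (C (lamPow Λ r)) * (X i - C (r i * b)))
    (f : CartanPolynomial n ι) :
    C (b - b ^ 2) * f
      = ⁅wittElt c₁ c₂ 𝔤 (Pi.single i 1) i, ⁅wittElt c₁ c₂ 𝔤 (-Pi.single i 1) i, f⁆⁆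
        - X i * (X i * f) + X i * f := by
  have hΛ : (C (C (lamPow Λ (Pi.single i 1))) * C (C (lamPow Λ (-Pi.single i 1))) :
      CartanPolynomial n ι) = 1 := by
    rw [← C_mul, ← C_mul, ← lamPow_add, add_neg_cancel, lamPow_zero, C_1, C_1]
  rw [H.wittElt_lie_eq_mul (-_) i f, H.wittElt_lie_eq_mul _ i (_ * _), hwitt, hwitt]
  simp only [map_mul, map_sub, map_pow, shiftBy_shiftBy, shiftBy_zero, shiftBy_X, shiftBy_C,
    add_neg_cancel, Pi.neg_apply, Pi.single_eq_same, Int.cast_neg, Int.cast_one, map_neg, map_one]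
  linear_combination (-(f * (X i - 1 + C b) * (X i - C b))) * hΛ

theorem loopElt_zero_lie_C_sub_sq_mul (H : IsPolynomialModule c₁ c₂ n hb) {Λ : Fin n → ℂˣ}
    {b : MvPolynomial ι ℂ} {i : Fin n}
    (hwitt : ∀ r, ⁅wittElt c₁ c₂ 𝔤 r i, (1 : CartanPolynomial n ι)⁆
      = C (C (lamPow Λ r)) * (X i - C (r i * b)))
    (x : 𝔤) (f : CartanPolynomial n ι) :
    ⁅loopElt c₁ c₂ (0 : Fin n → ℤ) x, C (b - b ^ 2) * f⁆
      = C (b - b ^ 2) * ⁅loopElt c₁ c₂ (0 : Fin n → ℤ) x, f⁆ := by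
  have hX : ∀ g : CartanPolynomial n ι, ⁅loopElt c₁ c₂ (0 : Fin n → ℤ) x, X i * g⁆
      = X i * ⁅loopElt c₁ c₂ (0 : Fin n → ℤ) x, g⁆ := fun g => by
    rw [H.loopElt_lie_X_mul, Pi.zero_apply, Int.cast_zero, sub_zero]
  rw [H.C_sub_sq_mul hwitt, H.C_sub_sq_mul hwitt, lie_add, lie_sub, hX, hX,
    wittElt_lie_loopElt_zero_lie, wittElt_lie_loopElt_zero_lie]

theorem loopElt_lie_wittElt_lie_C (H : IsPolynomialModule c₁ c₂ n hb) {Λ : Fin n → ℂˣ} {w : ℂ}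
    (hwitt : ∀ r i, ⁅wittElt c₁ c₂ 𝔤 r i, (1 : CartanPolynomial n ι)⁆
      = C (C (lamPow Λ r)) * (X i - C (r i * C w)))
    (r s : Fin n → ℤ) (i : Fin n) (x : 𝔤) (y : MvPolynomial ι ℂ) :
    ⁅loopElt c₁ c₂ s x, ⁅wittElt c₁ c₂ 𝔤 r i, (C y : CartanPolynomial n ι)⁆⁆
      = C (C (lamPow Λ r)) * ((X i - (s i : CartanPolynomial n ι) - C (r i * C w))
        * ⁅loopElt c₁ c₂ s x, (C y : CartanPolynomial n ι)⁆) := by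
  have hpoly : ⁅wittElt c₁ c₂ 𝔤 r i, (C y : CartanPolynomial n ι)⁆
      = map C (C (lamPow Λ r) * (X i - C (r i * w))) * C y := by
    rw [H.wittElt_lie_eq_mul, hwitt, shiftBy_C, mul_comm]
    simp only [map_mul, map_sub, map_C, map_X, map_intCast]
  rw [hpoly, H.loopElt_lie_map_mul]
  simp only [map_mul, map_sub, map_C, map_X, map_intCast, shiftBy_C, shiftBy_X]
  ring

theorem loopElt_zero_lie_C (H : IsPolynomialModule c₁ c₂ n hb) {Λ : Fin n → ℂˣ} {w : ℂ}
    (hwitt : ∀ r i, ⁅wittElt c₁ c₂ 𝔤 r i, (1 : CartanPolynomial n ι)⁆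
      = C (C (lamPow Λ r)) * (X i - C (r i * C w))) (x : 𝔤) (y : MvPolynomial ι ℂ) :
    ⁅loopElt c₁ c₂ (0 : Fin n → ℤ) x, (C y : CartanPolynomial n ι)⁆
      = C (constantCoeff ⁅loopElt c₁ c₂ (0 : Fin n → ℤ) x, (C y : CartanPolynomial n ι)⁆) := by
  refine eq_C_of_shiftBy_eq_self fun r => ?_
  rcases isEmpty_or_nonempty (Fin n) with hn | ⟨⟨i⟩⟩
  · rw [Subsingleton.elim r 0, shiftBy_zero]
  have hne : ⁅wittElt c₁ c₂ 𝔤 r i, (1 : CartanPolynomial n ι)⁆ ≠ 0 := by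
    rw [hwitt]
    refine mul_ne_zero (C_ne_zero.mpr (C_ne_zero.mpr (lamPow_ne_zero Λ r))) fun h => ?_
    have hdeg := congrArg totalDegree (sub_eq_zero.mp h)
    rw [totalDegree_X, totalDegree_C] at hdeg
    exact one_ne_zero hdeg
  have hcomm := wittElt_lie_loopElt_zero_lie (c₁ := c₁) (c₂ := c₂) r i x
    (C y : CartanPolynomial n ι)
  rw [H.wittElt_lie_eq_mul, H.loopElt_lie_wittElt_lie_C hwitt, Pi.zero_apply, Int.cast_zero,
    sub_zero, ← mul_assoc, ← hwitt, mul_comm] at hcomm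
  exact mul_left_cancel₀ hne hcomm

theorem loopElt_lie_C (H : IsPolynomialModule c₁ c₂ n hb) {Λ : Fin n → ℂˣ} {w : ℂ}
    (hwitt : ∀ r i, ⁅wittElt c₁ c₂ 𝔤 r i, (1 : CartanPolynomial n ι)⁆
      = C (C (lamPow Λ r)) * (X i - C (r i * C w)))
    (r : Fin n → ℤ) (x : 𝔤) (y : MvPolynomial ι ℂ) :
    ⁅loopElt c₁ c₂ r x, (C y : CartanPolynomial n ι)⁆ = C (C (lamPow Λ r))
      * C (constantCoeff ⁅loopElt c₁ c₂ (0 : Fin n → ℤ) x, (C y : CartanPolynomial n ι)⁆) := by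
  rcases eq_or_ne r 0 with rfl | hr
  · rw [lamPow_zero, C_1, C_1, one_mul]
    exact H.loopElt_zero_lie_C hwitt x y
  obtain ⟨i, hi⟩ := Function.ne_iff.mp hr
  have hinv : C (C (lamPow Λ r)) * C (C (lamPow Λ (-r))) = (1 : CartanPolynomial n ι) := by
    rw [← C_mul, ← C_mul, ← lamPow_add, add_neg_cancel, lamPow_zero, C_1, C_1]
  -- The bracket of `t^(-r) dᵢ` and `x(r)` is `rᵢ x(0)`.
  have hcomm := lie_lie (wittElt c₁ c₂ 𝔤 (-r) i) (loopElt c₁ c₂ r x) (C y : CartanPolynomial n ι)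
  rw [wittElt_lie_loopElt, neg_add_cancel, smul_lie, Algebra.smul_def, map_intCast,
    H.loopElt_zero_lie_C hwitt, H.wittElt_lie_eq_mul, hwitt,
    H.loopElt_lie_wittElt_lie_C hwitt] at hcomm
  have hq := eq_C_of_shiftBy_neg_mul_sub (c := r i * C w)
    (q := C (C (lamPow Λ (-r))) * ⁅loopElt c₁ c₂ r x, (C y : CartanPolynomial n ι)⁆) hi (by
      rw [map_mul, shiftBy_C, hcomm]
      simp only [Pi.neg_apply, Int.cast_neg, neg_mul, C_neg]
      ring)
  rw [← hq, ← mul_assoc, hinv, one_mul]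

theorem exists_scalar_witt_form [FiniteDimensional ℂ 𝔤] [LieAlgebra.IsKilling ℂ 𝔤]
    [Nontrivial 𝔤] [𝔥.IsCartanSubalgebra] (H : IsPolynomialModule c₁ c₂ n hb) :
    ∃ (Λ : Fin n → ℂˣ) (w : ℂ),
      (∀ (k : KA n) (f : CartanPolynomial n ι), ⁅cenElt c₁ c₂ 𝔤 k, f⁆ = 0) ∧
      ∀ r i, ⁅wittElt c₁ c₂ 𝔤 r i, (1 : CartanPolynomial n ι)⁆
        = C (C (lamPow Λ r)) * (X i - C (r i * C w)) := by
  obtain ⟨h, hh⟩ := exists_mem_cartan_killingForm_ne_zero 𝔥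
  obtain ⟨Λ, β, hloop, hwitt⟩ := H.exists_witt_form (h := h) <| by
    rintro rfl
    exact hh (by rw [ZeroMemClass.coe_zero, map_zero])
  have hcen := H.cenElt_lie_eq_zero hh hloop
  obtain ⟨b, hb'⟩ := (H.wittConstants hwitt hcen).exists_eq_mul
  simp only [hb'] at hwitt
  rcases isEmpty_or_nonempty (Fin n) with hn | ⟨⟨i⟩⟩
  · exact ⟨Λ, 0, hcen, fun _ i => hn.elim i⟩
  · obtain ⟨w, rfl⟩ := exists_eq_C_of_sub_sq_eq_C
      (H.eq_C_of_loopElt_zero_lie_C_mul (H.loopElt_zero_lie_C_sub_sq_mul fun r => hwitt r i))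
    exact ⟨Λ, w, hcen, hwitt⟩

theorem exists_normal_form [FiniteDimensional ℂ 𝔤] [LieAlgebra.IsKilling ℂ 𝔤]
    [Nontrivial 𝔤] [𝔥.IsCartanSubalgebra] (H : IsPolynomialModule c₁ c₂ n hb) :
    ∃ (Λ : Fin n → ℂˣ) (a : ℂ),
      (∀ (k : KA n) (f : CartanPolynomial n ι), ⁅cenElt c₁ c₂ 𝔤 k, f⁆ = 0) ∧
      (∀ r i (f : CartanPolynomial n ι), ⁅wittElt c₁ c₂ 𝔤 r i, f⁆
        = C (C (lamPow Λ r)) * (shiftBy r f * (X i - C (C (r i * (a + 1)))))) ∧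
      (∀ (x : 𝔤) (y : MvPolynomial ι ℂ),
        ⁅loopElt c₁ c₂ (0 : Fin n → ℤ) x, (C y : CartanPolynomial n ι)⁆
          = C (constantCoeff
            ⁅loopElt c₁ c₂ (0 : Fin n → ℤ) x, (C y : CartanPolynomial n ι)⁆)) ∧
      ∀ (r : Fin n → ℤ) (x : 𝔤) (y : MvPolynomial ι ℂ) (q : MvPolynomial (Fin n) ℂ),
        ⁅loopElt c₁ c₂ r x, (C y * map C q : CartanPolynomial n ι)⁆
          = C (C (lamPow Λ r)) * (⁅loopElt c₁ c₂ (0 : Fin n → ℤ) x, (C y : CartanPolynomial n ι)⁆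
            * shiftBy r (map C q)) := by
  obtain ⟨Λ, w, hcen, hwitt⟩ := H.exists_scalar_witt_form
  have hzero := H.loopElt_zero_lie_C hwitt
  refine ⟨Λ, w - 1, hcen, fun r i f => ?_, hzero, fun r x y q => ?_⟩
  · rw [H.wittElt_lie_eq_mul, hwitt]
    simp only [sub_add_cancel, C_mul, map_intCast]
    ring
  · rw [mul_comm (C y), H.loopElt_lie_map_mul, H.loopElt_lie_C hwitt, ← hzero]
    ring

end IsPolynomialModule

end FullToroidal

namespace FullToroidalAlgebra

open FullToroidal

variable {c₁ c₂ : ℂ} {n : ℕ} {𝔤 : Type*} [LieRing 𝔤] [LieAlgebra ℂ 𝔤]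

theorem map_lie_of_generators {N M : Type*} [AddCommGroup N] [Module ℂ N]
    [LieRingModule (FullToroidalAlgebra c₁ c₂ n 𝔤) N]
    [LieModule ℂ (FullToroidalAlgebra c₁ c₂ n 𝔤) N] [AddCommGroup M] [Module ℂ M]
    [LieRingModule (FullToroidalAlgebra c₁ c₂ n 𝔤) M]
    [LieModule ℂ (FullToroidalAlgebra c₁ c₂ n 𝔤) M] (F : N →ₗ[ℂ] M) (m : N)
    (hloop : ∀ (r : Fin n → ℤ) (x : 𝔤), F ⁅loopElt c₁ c₂ r x, m⁆ = ⁅loopElt c₁ c₂ r x, F m⁆)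
    (hcen : ∀ k : KA n, F ⁅cenElt c₁ c₂ 𝔤 k, m⁆ = ⁅cenElt c₁ c₂ 𝔤 k, F m⁆)
    (hwitt : ∀ (r : Fin n → ℤ) (i : Fin n), F ⁅wittElt c₁ c₂ 𝔤 r i, m⁆ = ⁅wittElt c₁ c₂ 𝔤 r i, F m⁆)
    (X : FullToroidalAlgebra c₁ c₂ n 𝔤) : F ⁅X, m⁆ = ⁅X, F m⁆ := by
  let S : FullToroidalAlgebra c₁ c₂ n 𝔤 →ₗ[ℂ] M :=
    { toFun := fun X => F ⁅X, m⁆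
      map_add' := fun X Y => by rw [add_lie, map_add]
      map_smul' := fun c X => by rw [smul_lie, map_smul, RingHom.id_apply] }
  let T : FullToroidalAlgebra c₁ c₂ n 𝔤 →ₗ[ℂ] M :=
    { toFun := fun X => ⁅X, F m⁆
      map_add' := fun X Y => add_lie X Y (F m)
      map_smul' := fun c X => smul_lie c X (F m) }
  exact DFunLike.congr_fun (linearMap_ext (S := S) (T := T) hloop hcen hwitt) X

variable (c₁ c₂ n 𝔤) in
/-- The embedding `x ↦ x(0)` of `𝔤` into `ℒ`. -/
def loopZeroHom : 𝔤 →ₗ⁅ℂ⁆ FullToroidalAlgebra c₁ c₂ n 𝔤 where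
  __ := loopElt c₁ c₂ (0 : Fin n → ℤ)
  map_lie' {x y} := (loopElt_zero_lie_loopElt_zero x y).symm

section Cartan

variable {𝔥 : LieSubalgebra ℂ 𝔤}

theorem cartanMap_inl (h : 𝔥) : cartanMap c₁ c₂ n 𝔥 (h, 0) = loopElt c₁ c₂ 0 (h : 𝔤) := by
  ext1
  · rfl
  · rfl
  · simp [cartanMap, loopElt, ofLoop]

theorem cartanMap_inr_single (i : Fin n) :
    cartanMap c₁ c₂ n 𝔥 (0, Pi.single i 1) = wittElt c₁ c₂ 𝔤 0 i := by
  ext1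
  · simp [cartanMap, wittElt, ofDer]
  · rfl
  · simp [cartanMap, wittElt, ofDer, mono_zero, Pi.single_apply]

theorem one_tmul_injective : Function.Injective fun x : 𝔤 => (1 : Laurent n) ⊗ₜ[ℂ] x := by
  refine Function.LeftInverse.injective
    (g := TensorProduct.lid ℂ 𝔤 ∘ LinearMap.rTensor 𝔤 ((monoBasis n).coord 0)) fun x => ?_
  rw [← mono_zero, ← monoBasis_apply]
  simp

theorem cartanMap_injective : Function.Injective (cartanMap c₁ c₂ n 𝔥) := by
  rw [← LinearMap.ker_eq_bot, LinearMap.ker_eq_bot']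
  rintro ⟨h, w⟩ hzero
  have hloop : (1 : Laurent n) ⊗ₜ[ℂ] (h : 𝔤) = 1 ⊗ₜ[ℂ] (0 : 𝔤) :=
    (congrArg loop hzero).trans (TensorProduct.tmul_zero _ _).symm
  have hder : (∑ i, w i • euler i : Witt n) = 0 := congrArg der hzero
  refine Prod.ext (Subtype.ext (one_tmul_injective hloop)) (funext fun j => ?_)
  have hone : (1 : Laurent n) ≠ 0 := by
    rw [← mono_zero, ← monoBasis_apply]
    exact (monoBasis n).ne_zero 0
  have hcoef := coef_sum_euler w j
  rw [hder, map_zero] at hcoef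
  exact (smul_eq_zero.mp hcoef.symm).resolve_right hone

variable (c₁ c₂ n 𝔥) in
/-- The linear equivalence of `𝔥 ⊕ ℂⁿ` with `𝔥̃ₙ`. -/
def cartanEquiv : (𝔥 × (Fin n → ℂ)) ≃ₗ[ℂ] cartan c₁ c₂ n 𝔥 :=
  LinearEquiv.ofInjective (cartanMap c₁ c₂ n 𝔥) cartanMap_injective

theorem coe_cartanEquiv (p : 𝔥 × (Fin n → ℂ)) :
    (cartanEquiv c₁ c₂ n 𝔥 p : FullToroidalAlgebra c₁ c₂ n 𝔤) = cartanMap c₁ c₂ n 𝔥 p := rfl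

instance isLieAbelian_cartan [IsLieAbelian 𝔥] : IsLieAbelian (cartan c₁ c₂ n 𝔥) := by
  refine ⟨?_⟩
  rintro ⟨_, ⟨x, w⟩, rfl⟩ ⟨_, ⟨y, w'⟩, rfl⟩
  apply Subtype.ext
  change ⁅cartanMap c₁ c₂ n 𝔥 (x, w), cartanMap c₁ c₂ n 𝔥 (y, w')⁆ = 0
  have hxy : ⁅(x : 𝔤), (y : 𝔤)⁆ = 0 := by
    rw [← LieSubalgebra.coe_bracket, trivial_lie_zero, ZeroMemClass.coe_zero]
  ext1
  · simp [cartanMap, loop_lie, derLoop_tmul, hxy]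
  · simp [cartanMap, cen_lie, loopCocycle_tmul, phi, phi₁_eq, phi₂_eq, jac_sum_euler, trPair,
      dClass_one]
  · simp [cartanMap, der_lie, sum_euler_comm]

variable {ι : Type*} (hb : Module.Basis ι ℂ 𝔥)

variable (c₁ c₂ n) in
/-- The basis of `𝔥̃ₙ` consisting of the `dᵢ` and a basis of `𝔥`. -/
def cartanBasis : Module.Basis (Fin n ⊕ ι) ℂ (cartan c₁ c₂ n 𝔥) :=
  ((hb.prod (Pi.basisFun ℂ (Fin n))).map (cartanEquiv c₁ c₂ n 𝔥)).reindex (Equiv.sumComm _ _)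

theorem cartanBasis_inl (i : Fin n) :
    cartanBasis c₁ c₂ n hb (Sum.inl i) = cartanEquiv c₁ c₂ n 𝔥 (0, Pi.single i 1) := by
  simp [cartanBasis]

theorem cartanBasis_inr (k : ι) :
    cartanBasis c₁ c₂ n hb (Sum.inr k) = cartanEquiv c₁ c₂ n 𝔥 (hb k, 0) := by
  simp [cartanBasis]

open MvPolynomial in
theorem sumAlgEquiv_linearPoly_cartanBasis (h : 𝔥) :
    sumAlgEquiv ℂ (Fin n) ι (linearPoly (cartanBasis c₁ c₂ n hb) (cartanEquiv c₁ c₂ n 𝔥 (h, 0)))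
      = C (linearPoly hb h) := by
  have hlin : (sumAlgEquiv ℂ (Fin n) ι).toLinearMap ∘ₗ linearPoly (cartanBasis c₁ c₂ n hb)
      ∘ₗ (cartanEquiv c₁ c₂ n 𝔥).toLinearMap ∘ₗ LinearMap.inl ℂ 𝔥 (Fin n → ℂ)
      = (IsScalarTower.toAlgHom ℂ (MvPolynomial ι ℂ) (CartanPolynomial n ι)).toLinearMap
        ∘ₗ linearPoly hb := by
    refine hb.ext fun k => ?_
    simp only [LinearMap.comp_apply, LinearMap.inl_apply, LinearEquiv.coe_coe, linearPoly_basis,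
      ← cartanBasis_inr]
    exact sumAlgEquiv_X_inr ℂ (Fin n) ι k
  exact DFunLike.congr_fun hlin h

end Cartan

end FullToroidalAlgebra

namespace FullToroidal

open MvPolynomial FullToroidalAlgebra

theorem exists_lieModule_of_lie_mem_range {R L L' V P : Type*} [CommRing R] [LieRing L]
    [LieAlgebra R L] [LieRing L'] [LieAlgebra R L'] [AddCommGroup V] [Module R V]
    [AddCommGroup P] [Module R P] [LieRingModule L P] [LieModule R L P] (φ : L' →ₗ⁅R⁆ L)
    (j : V →ₗ[R] P) (hj : Function.Injective j) (hrange : ∀ x v, ⁅φ x, j v⁆ ∈ LinearMap.range j) :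
    ∃ (_ : LieRingModule L' V) (_ : LieModule R L' V),
      ∀ (x : L') (v : V), j ⁅x, v⁆ = ⁅φ x, j v⁆ := by
  choose act hact using hrange
  let lieRingModule : LieRingModule L' V :=
    { bracket := act
      add_lie := fun x y v => hj (by simp only [map_add, hact, add_lie])
      lie_add := fun x v w => hj (by simp only [map_add, hact, lie_add])
      leibniz_lie := fun x y v => hj (by
        simp only [map_add, hact, LieHom.map_lie]
        exact leibniz_lie (φ x) (φ y) (j v)) }
  exact ⟨lieRingModule,
    { smul_lie := fun c x v => hj (by
        change j (act (c • x) v) = j (c • act x v)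
        simp only [map_smul, hact, smul_lie])
      lie_smul := fun c x v => hj (by
        change j (act x (c • v)) = j (c • act x v)
        simp only [map_smul, hact, lie_smul]) }, hact⟩

variable {c₁ c₂ : ℂ} {n : ℕ} {𝔤 : Type*} [LieRing 𝔤] [LieAlgebra ℂ 𝔤] {𝔥 : LieSubalgebra ℂ 𝔤}
  {ι : Type*}

theorem exists_isPolynomialModule [IsLieAbelian 𝔥] (hb : Module.Basis ι ℂ 𝔥) {M : Type*}
    [AddCommGroup M] [Module ℂ M] [LieRingModule (FullToroidalAlgebra c₁ c₂ n 𝔤) M]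
    [LieModule ℂ (FullToroidalAlgebra c₁ c₂ n 𝔤) M]
    (hM : IsFreeOfRankOne (FullToroidalAlgebra.cartan c₁ c₂ n 𝔥) M) :
    ∃ (_ : LieRingModule (FullToroidalAlgebra c₁ c₂ n 𝔤) (CartanPolynomial n ι))
      (_ : LieModule ℂ (FullToroidalAlgebra c₁ c₂ n 𝔤) (CartanPolynomial n ι)),
      IsPolynomialModule c₁ c₂ n hb ∧
        Nonempty (CartanPolynomial n ι ≃ₗ⁅ℂ, FullToroidalAlgebra c₁ c₂ n 𝔤⁆ M) := by
  obtain ⟨E, hE⟩ := (isFreeOfRankOne_iff (cartanBasis c₁ c₂ n hb)).mp hM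
  let s := sumAlgEquiv ℂ (Fin n) ι
  let F : CartanPolynomial n ι ≃ₗ[ℂ] M := s.symm.toLinearEquiv.trans E
  have hF : ∀ (x : cartan c₁ c₂ n 𝔥) (f : CartanPolynomial n ι),
      F (s (linearPoly (cartanBasis c₁ c₂ n hb) x) * f)
        = ⁅(x : FullToroidalAlgebra c₁ c₂ n 𝔤), F f⁆ := fun x f => by
    change E (s.symm (s _ * f)) = ⁅_, E (s.symm f)⁆
    rw [map_mul, AlgEquiv.symm_apply_apply, hE]
  obtain ⟨lieRingModule, lieModule, hlie⟩ := exists_lieModule_of_lie_mem_range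
    (LieHom.id : FullToroidalAlgebra c₁ c₂ n 𝔤 →ₗ⁅ℂ⁆ _) F.toLinearMap F.injective
    fun x f => LinearMap.range_eq_top.mpr F.surjective ▸ Submodule.mem_top
  refine ⟨lieRingModule, lieModule, ⟨fun i f => ?_, fun h f => ?_⟩,
    ⟨{ F with map_lie' := fun {X f} => hlie X f }⟩⟩
  · have hX : s (X (Sum.inl i)) = X i := sumAlgEquiv_X_inl ℂ (Fin n) ι i
    refine F.injective ((hlie _ f).trans ?_)
    rw [← cartanMap_inr_single (𝔥 := 𝔥), ← coe_cartanEquiv, ← cartanBasis_inl hb, ← hX,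
      ← linearPoly_basis (cartanBasis c₁ c₂ n hb)]
    exact (hF _ f).symm
  · refine F.injective ((hlie _ f).trans ?_)
    rw [← cartanMap_inl, ← coe_cartanEquiv, ← sumAlgEquiv_linearPoly_cartanBasis (c₁ := c₁)
      (c₂ := c₂)]
    exact (hF _ f).symm

end FullToroidal

@[elab_as_elim]
theorem HatModule.induction_on {n : ℕ} {Λ : Fin n → ℂˣ} {a : ℂ} {V : Type*} [AddCommGroup V]
    [Module ℂ V] {motive : HatModule Λ a V → Prop} (m : HatModule Λ a V) (zero : motive 0)
    (tmul : ∀ v p, motive (HatModule.tmul Λ a v p))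
    (add : ∀ m m', motive m → motive m' → motive (m + m')) : motive m :=
  TensorProduct.induction_on m zero tmul add

namespace FullToroidal

open MvPolynomial FullToroidalAlgebra

variable {n : ℕ} {ι : Type*}

theorem shiftBy_map_C (r : Fin n → ℤ) (q : MvPolynomial (Fin n) ℂ) :
    shiftBy r (map C q : CartanPolynomial n ι) = map C (tau r q) := by
  induction q using MvPolynomial.induction_on with
  | C c => rw [map_C, shiftBy_C, tau, aeval_C, MvPolynomial.algebraMap_eq, map_C]
  | add p q hp hq => rw [map_add, map_add, hp, hq, map_add, map_add]
  | mul_X p i hp =>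
    rw [map_mul, map_mul, hp, map_mul, map_mul, map_X, shiftBy_X, tau, aeval_X, map_sub, map_X,
      map_C, map_intCast, map_intCast]

/-- The identification of the space `U(𝔥) ⊗ ℂ[d₁, …, dₙ]` of a hat module with `U(𝔥̃ₙ)`, in the
coordinates given by a basis of `𝔥` indexed by `ι`. -/
def hatModuleEquiv (Λ : Fin n → ℂˣ) (a : ℂ) :
    HatModule Λ a (MvPolynomial ι ℂ) ≃ₗ[ℂ] CartanPolynomial n ι :=
  (algebraTensorAlgEquiv ℂ (MvPolynomial ι ℂ) (σ := Fin n)).toLinearEquiv.restrictScalars ℂ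

theorem hatModuleEquiv_tmul (Λ : Fin n → ℂˣ) (a : ℂ) (v : MvPolynomial ι ℂ)
    (q : MvPolynomial (Fin n) ℂ) :
    hatModuleEquiv Λ a (HatModule.tmul Λ a v q) = C v * map C q := by
  change algebraTensorAlgEquiv ℂ (MvPolynomial ι ℂ) (v ⊗ₜ q) = _
  rw [algebraTensorAlgEquiv_tmul, MvPolynomial.smul_eq_C_mul]
  rfl

theorem hatModuleEquiv_smul_tmul (Λ : Fin n → ℂˣ) (a c : ℂ) (v : MvPolynomial ι ℂ)
    (q : MvPolynomial (Fin n) ℂ) :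
    hatModuleEquiv Λ a (c • HatModule.tmul Λ a v q) = C (C c) * (C v * map C q) := by
  rw [map_smul, hatModuleEquiv_tmul, Algebra.smul_def]
  rfl

variable {c₁ c₂ : ℂ} {𝔤 : Type*} [LieRing 𝔤] [LieAlgebra ℂ 𝔤]
  [LieRingModule (FullToroidalAlgebra c₁ c₂ n 𝔤) (CartanPolynomial n ι)]
  [LieModule ℂ (FullToroidalAlgebra c₁ c₂ n 𝔤) (CartanPolynomial n ι)]

theorem nonempty_lieModuleEquiv_hatModule [LieRingModule 𝔤 (MvPolynomial ι ℂ)]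
    [LieModule ℂ 𝔤 (MvPolynomial ι ℂ)] {Λ : Fin n → ℂˣ} {a : ℂ}
    (hcen : ∀ (k : KA n) (f : CartanPolynomial n ι), ⁅cenElt c₁ c₂ 𝔤 k, f⁆ = 0)
    (hwitt : ∀ r i (f : CartanPolynomial n ι), ⁅wittElt c₁ c₂ 𝔤 r i, f⁆
      = C (C (lamPow Λ r)) * (shiftBy r f * (X i - C (C (r i * (a + 1))))))
    (hloop : ∀ (r : Fin n → ℤ) (x : 𝔤) (y : MvPolynomial ι ℂ) (q : MvPolynomial (Fin n) ℂ),
      ⁅loopElt c₁ c₂ r x, (C y * map C q : CartanPolynomial n ι)⁆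
        = C (C (lamPow Λ r)) * (C ⁅x, y⁆ * shiftBy r (map C q))) :
    Nonempty (CartanPolynomial n ι ≃ₗ⁅ℂ, FullToroidalAlgebra c₁ c₂ n 𝔤⁆
      HatModule Λ a (MvPolynomial ι ℂ)) := by
  have hlie : ∀ (Z : FullToroidalAlgebra c₁ c₂ n 𝔤) (m : HatModule Λ a (MvPolynomial ι ℂ)),
      hatModuleEquiv Λ a ⁅Z, m⁆ = ⁅Z, hatModuleEquiv Λ a m⁆ := by
    intro Z m
    induction m using HatModule.induction_on with
    | zero => rw [lie_zero, map_zero, lie_zero]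
    | add m m' hm hm' => rw [lie_add, map_add, map_add, lie_add, hm, hm']
    | tmul v q =>
      refine map_lie_of_generators (hatModuleEquiv Λ a).toLinearMap _ (fun r x => ?_)
        (fun k => ?_) (fun r i => ?_) Z
      · refine (congrArg (hatModuleEquiv Λ a) (HatModule.lie_loop Λ a _ r x v q)).trans ?_
        rw [hatModuleEquiv_smul_tmul, ← shiftBy_map_C, ← hloop]
        exact congrArg _ (hatModuleEquiv_tmul Λ a v q).symm
      · refine (congrArg (hatModuleEquiv Λ a) (HatModule.lie_cen Λ a _ k _)).trans ?_
        exact (map_zero _).trans (hcen k _).symm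
      · refine (congrArg (hatModuleEquiv Λ a) (HatModule.lie_witt Λ a _ r i v q)).trans ?_
        refine Eq.trans ?_ (congrArg (⁅wittElt c₁ c₂ 𝔤 r i, ·⁆)
          (hatModuleEquiv_tmul Λ a v q).symm)
        rw [hatModuleEquiv_smul_tmul, hwitt, map_mul (shiftBy r), shiftBy_C, shiftBy_map_C,
          map_mul (MvPolynomial.map C), map_sub, map_X, map_C, mul_assoc (C v)]
  exact ⟨LieModuleEquiv.symm { hatModuleEquiv Λ a with map_lie' := fun {Z m} => hlie Z m }⟩

variable {𝔥 : LieSubalgebra ℂ 𝔤} {hb : Module.Basis ι ℂ 𝔥}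

theorem IsPolynomialModule.exists_lieModule [IsLieAbelian 𝔥]
    (H : IsPolynomialModule c₁ c₂ n hb)
    (hzero : ∀ (x : 𝔤) (y : MvPolynomial ι ℂ),
      ⁅loopElt c₁ c₂ (0 : Fin n → ℤ) x, (C y : CartanPolynomial n ι)⁆
        = C (constantCoeff ⁅loopElt c₁ c₂ (0 : Fin n → ℤ) x, (C y : CartanPolynomial n ι)⁆)) :
    ∃ (_ : LieRingModule 𝔤 (MvPolynomial ι ℂ)) (_ : LieModule ℂ 𝔤 (MvPolynomial ι ℂ)),
      IsFreeOfRankOne 𝔥 (MvPolynomial ι ℂ) ∧ ∀ (x : 𝔤) (y : MvPolynomial ι ℂ),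
        (C ⁅x, y⁆ : CartanPolynomial n ι) = ⁅loopElt c₁ c₂ (0 : Fin n → ℤ) x, C y⁆ := by
  obtain ⟨lieRingModule, lieModule, hlie⟩ := exists_lieModule_of_lie_mem_range
    (loopZeroHom c₁ c₂ n 𝔤)
    (IsScalarTower.toAlgHom ℂ (MvPolynomial ι ℂ) (CartanPolynomial n ι)).toLinearMap
    (C_injective (Fin n) (MvPolynomial ι ℂ)) fun x y => ⟨_, (hzero x y).symm⟩
  refine ⟨lieRingModule, lieModule, (isFreeOfRankOne_iff hb).mpr
    ⟨LinearEquiv.refl ℂ _, fun h y => C_injective (Fin n) _ ?_⟩, hlie⟩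
  exact C_mul.trans ((H.cartan_lie h (C y)).symm.trans (hlie h y).symm)

end FullToroidal

end

open FullToroidal in
theorem mainTheorem2_general {𝔤 : Type u} [LieRing 𝔤] [LieAlgebra ℂ 𝔤] [FiniteDimensional ℂ 𝔤]
    [LieAlgebra.IsKilling ℂ 𝔤] [Nontrivial 𝔤] (𝔥 : LieSubalgebra ℂ 𝔤) [𝔥.IsCartanSubalgebra]
    (n : ℕ) (c₁ c₂ : ℂ)
    (M : Type v) [AddCommGroup M] [Module ℂ M] [LieRingModule (FullToroidalAlgebra c₁ c₂ n 𝔤) M]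
    [LieModule ℂ (FullToroidalAlgebra c₁ c₂ n 𝔤) M]
    (hM : IsFreeOfRankOne (FullToroidalAlgebra.cartan c₁ c₂ n 𝔥) M) :
    ∃ (Λ : Fin n → ℂˣ) (a : ℂ) (V : Type u) (_ : AddCommGroup V) (_ : Module ℂ V)
      (_ : LieRingModule 𝔤 V) (_ : LieModule ℂ 𝔤 V),
      IsFreeOfRankOne 𝔥 V ∧
        Nonempty (M ≃ₗ⁅ℂ, FullToroidalAlgebra c₁ c₂ n 𝔤⁆ HatModule Λ a V) := by
  obtain ⟨_, _, H, ⟨e⟩⟩ := exists_isPolynomialModule (Module.Free.chooseBasis ℂ 𝔥) hM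
  obtain ⟨Λ, a, hcen, hwitt, hzero, hloop⟩ := H.exists_normal_form
  obtain ⟨_, _, hfree, hlie⟩ := H.exists_lieModule hzero
  simp only [← hlie] at hloop
  obtain ⟨e'⟩ := nonempty_lieModuleEquiv_hatModule hcen hwitt hloop
  exact ⟨Λ, a, _, _, _, _, _, hfree, ⟨e.symm.trans e'⟩⟩

theorem mainTheorem2 {𝔤 : Type u} [LieRing 𝔤] [LieAlgebra ℂ 𝔤] [FiniteDimensional ℂ 𝔤]
    [LieAlgebra.IsSimple ℂ 𝔤] (𝔥 : LieSubalgebra ℂ 𝔤) [𝔥.IsCartanSubalgebra]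
    (n : ℕ) (c₁ c₂ : ℂ)
    (M : Type v) [AddCommGroup M] [Module ℂ M] [LieRingModule (FullToroidalAlgebra c₁ c₂ n 𝔤) M]
    [LieModule ℂ (FullToroidalAlgebra c₁ c₂ n 𝔤) M]
    (hM : IsFreeOfRankOne (FullToroidalAlgebra.cartan c₁ c₂ n 𝔥) M) :
    ∃ (Λ : Fin n → ℂˣ) (a : ℂ) (V : Type u) (_ : AddCommGroup V) (_ : Module ℂ V)
      (_ : LieRingModule 𝔤 V) (_ : LieModule ℂ 𝔤 V),
      IsFreeOfRankOne 𝔥 V ∧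
        Nonempty (M ≃ₗ⁅ℂ, FullToroidalAlgebra c₁ c₂ n 𝔤⁆ HatModule Λ a V) := by
  have : Nontrivial 𝔤 := LieAlgebra.IsSimple.nontrivial ℂ 𝔤
  exact mainTheorem2_general 𝔥 n c₁ c₂ M hM
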